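/- Let $X$ be a (real) Banach lattice. A vector $a \in X$ with $a\ge 0$, $a\neq 0$ is an atom if the principal ideal $I_a=\{x\in X : |x|\le c|a| \text{ for some real } c\ge 0\}$ coincides with the linear span of $a$; $X$ is atomic if it is the band generated by all its atoms; and $X$ is order continuous if $\|x_\alpha\|\to 0$ for every net $x_\alpha\downarrow 0$ in $X$. A sequence $(x_n)$ in $X$ un-converges to $x\in X$ if $\bigl\|\,|x_n-x|\wedge u\,\bigr\|\to 0$ for every $u\in X$ with $u\ge 0$. A bounded linear operator $T\colon E\to X$ from a (real) Banach space $E$ with closed unit ball $B_E$ is weakly compact if $T(B_E)$ is relatively compact in the weak topology of $X$, and sequentially un-compact if every sequence in $T(B_E)$ has a subsequence that un-converges to some vector of $X$. Theorem. A Banach lattice $X$ is atomic and order continuous if and only if, for every Banach space $E$, every weakly compact operator $T\colon E\to X$ is sequentially un-compact. -/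

import Mathlib

open Filter Topology

universe u v

namespace BanachLattice

/-! Throughout, `X` is (at least) a normed space over `ℝ` with a lattice order. -/

section Order

variable {X : Type*} [NormedAddCommGroup X] [NormedSpace ℝ X] [Lattice X]

/-- The principal ideal `I_a` generated by `a`. -/
def principalIdeal (a : X) : Set X := {x | ∃ c : ℝ, 0 ≤ c ∧ |x| ≤ c • |a|}

/-- An atom: a positive non-zero vector whose principal ideal coincides with its linear span. -/
def IsAtomVector (a : X) : Prop :=
  0 ≤ a ∧ a ≠ 0 ∧ principalIdeal a = (Submodule.span ℝ {a} : Set X)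

/-- A band: a solid linear subspace (an ideal) that contains the supremum of each of its subsets
whenever that supremum exists in `X`. -/
structure IsBand (B : Submodule ℝ X) : Prop where
  solid : ∀ ⦃x y : X⦄, y ∈ B → |x| ≤ |y| → x ∈ B
  isLUB_mem : ∀ ⦃S : Set X⦄ ⦃x : X⦄, S ⊆ (B : Set X) → IsLUB S x → x ∈ B

/-- The band generated by a set: the intersection of all bands that contain it. -/
def bandGenerated (A : Set X) : Submodule ℝ X :=
  sInf {B : Submodule ℝ X | IsBand B ∧ A ⊆ (B : Set X)}

end Order

/-- `X` is atomic: it is the band generated by all its atoms. -/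
def IsAtomicLattice (X : Type*) [NormedAddCommGroup X] [NormedSpace ℝ X] [Lattice X] : Prop :=
  bandGenerated {a : X | IsAtomVector a} = ⊤

/-- `X` is order continuous: `x_α ↓ 0` implies `‖x_α‖ → 0` for every net `(x_α)` in `X`.
A net that decreases to `0` may be replaced by its range, a subset of `X` directed downwards, so
index sets in the universe of `X` cover all nets. -/
def IsOrderContinuous (X : Type u) [NormedAddCommGroup X] [Lattice X] : Prop :=
  ∀ (ι : Type u) [Preorder ι] [IsDirectedOrder ι] [Nonempty ι] (x : ι → X),
    Antitone x → IsGLB (Set.range x) 0 → Tendsto (fun α => ‖x α‖) atTop (𝓝 0)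

/-- Un-convergence (unbounded norm convergence) of `x` to `y` along the filter `l`:
`‖|x_α - y| ∧ u‖ → 0` for every `u ≥ 0`. -/
def UnTendsto {X ι : Type*} [NormedAddCommGroup X] [Lattice X]
    (x : ι → X) (l : Filter ι) (y : X) : Prop :=
  ∀ u : X, 0 ≤ u → Tendsto (fun α => ‖|x α - y| ⊓ u‖) l (𝓝 0)

/-- `A` is relatively sequentially un-compact: every sequence in `A` has a subsequence which
un-converges to some vector of `X`. -/
def IsRelSeqUnCompact {X : Type*} [NormedAddCommGroup X] [Lattice X] (A : Set X) : Prop :=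
  ∀ x : ℕ → X, (∀ n, x n ∈ A) →
    ∃ y : X, ∃ φ : ℕ → ℕ, StrictMono φ ∧ UnTendsto (x ∘ φ) atTop y

section Operators

variable {E X : Type*} [NormedAddCommGroup E] [NormedSpace ℝ E]
  [NormedAddCommGroup X] [NormedSpace ℝ X]

/-- `T` is sequentially un-compact: the image of the closed unit ball of `E` is relatively
sequentially un-compact in `X`. -/
def IsSeqUnCompactOperator [Lattice X] (T : E →L[ℝ] X) : Prop :=
  IsRelSeqUnCompact (T '' Metric.closedBall (0 : E) 1)

/-- `T` is weakly compact: the image of the closed unit ball of `E` is relatively compact in the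
weak topology of `X`. -/
def IsWeaklyCompactOperator (T : E →L[ℝ] X) : Prop :=
  IsCompact (closure (toWeakSpace ℝ X '' (T '' Metric.closedBall (0 : E) 1)))

end Operators

end BanachLattice

namespace BanachLattice

/-! Both directions work with `MonotoneBoundedCauchy`, which in a Banach lattice is equivalent to
order continuity.

Suppose `X` is atomic and order continuous. Every vector `u` is a norm limit of meets of `u` with
finite sums of atoms (`mem_closure_inf_atomSums`), so a sequence in `T(B_E)` meets only countably
many atoms up to proportionality, and un-convergence can be tested on atoms
(`unTendsto_of_forall_atom`). Each atom has a continuous coordinate functional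
(`exists_coordinate`). A diagonal subsequence makes the countably many relevant coordinates
converge, and a weak cluster point of it has these limits as its coordinates, so it is the un-limit.

Conversely, an order bounded weakly null sequence is the image of the unit vectors under a weakly
compact operator on `ℓ¹`. For order bounded sequences un-convergence is norm convergence, so such a
sequence has a norm null subsequence (`exists_subseq_tendsto_zero`). This is used twice. Increments
of an increasing order bounded sequence are weakly null, which gives order continuity. If a nonzero
`u ≥ 0` were disjoint from all atoms, some nonzero `w` in `[0, u]` would carry a strictly positive
functional `f`. Halving components repeatedly with respect to `f` would then produce Rademacher
vectors of modulus `w`. They are weakly null by `tendsto_functional_rademacher`, yet have constant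
norm `‖w‖ > 0`. -/

theorem inf_eq_zero_of_le {X : Type*} [Zero X] [Lattice X] {x y x' y' : X} (hx' : 0 ≤ x')
    (hy' : 0 ≤ y') (hx : x' ≤ x) (hy : y' ≤ y) (h : x ⊓ y = 0) : x' ⊓ y' = 0 :=
  le_antisymm ((inf_le_inf hx hy).trans h.le) (le_inf hx' hy')

/-! ### Disjointness and scalar multiplication in vector lattices. -/

section LatticeGroup

variable {X : Type*} [AddCommGroup X] [Lattice X] [IsOrderedAddMonoid X]

theorem add_inf_le_inf_add_inf {x y z : X} (hx : 0 ≤ x) (hy : 0 ≤ y) (hz : 0 ≤ z) :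
    (x + y) ⊓ z ≤ x ⊓ z + y ⊓ z := by
  have h1 : (x + y) ⊓ z ≤ x + y ⊓ z := by
    rw [add_inf]
    exact le_inf inf_le_left (inf_le_right.trans (le_add_of_nonneg_left hx))
  have h2 : (x + y) ⊓ z ≤ z + y ⊓ z :=
    inf_le_right.trans (le_add_of_nonneg_right (le_inf hy hz))
  rw [inf_add]
  exact le_inf h1 h2

theorem inf_add_le_inf_add_inf {x y z : X} (hx : 0 ≤ x) (hy : 0 ≤ y) (hz : 0 ≤ z) :
    z ⊓ (x + y) ≤ z ⊓ x + z ⊓ y := by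
  simpa only [inf_comm z] using add_inf_le_inf_add_inf hx hy hz

theorem add_inf_eq_zero {x y z : X} (hx : 0 ≤ x) (hy : 0 ≤ y) (hz : 0 ≤ z)
    (hxz : x ⊓ z = 0) (hyz : y ⊓ z = 0) : (x + y) ⊓ z = 0 := by
  refine le_antisymm ?_ (le_inf (add_nonneg hx hy) hz)
  simpa [hxz, hyz] using add_inf_le_inf_add_inf hx hy hz

theorem sum_inf_eq_zero {ι : Type*} (s : Finset ι) {x : ι → X} {z : X} (hx : ∀ i ∈ s, 0 ≤ x i)
    (hz : 0 ≤ z) (h : ∀ i ∈ s, x i ⊓ z = 0) : (∑ i ∈ s, x i) ⊓ z = 0 := by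
  classical
  induction s using Finset.induction_on with
  | empty => simpa using hz
  | insert i s hi ih =>
    rw [Finset.sum_insert hi]
    simp only [Finset.mem_insert, forall_eq_or_imp] at hx h
    exact add_inf_eq_zero hx.1 (Finset.sum_nonneg hx.2) hz h.1 (ih hx.2 h.2)

theorem sup_eq_add_of_inf_eq_zero {x y : X} (h : x ⊓ y = 0) : x ⊔ y = x + y := by
  rw [← inf_add_sup x y, h, zero_add]

theorem abs_sub_eq_add_of_inf_eq_zero {x y : X} (h : x ⊓ y = 0) : |x - y| = x + y := by
  rw [abs_sub_comm, ← sup_sub_inf_eq_abs_sub, h, sub_zero, sup_eq_add_of_inf_eq_zero h]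

theorem le_of_le_add_of_inf_eq_zero {x y z : X} (hx : 0 ≤ x) (hy : 0 ≤ y) (hz : 0 ≤ z)
    (h : x ≤ y + z) (hxy : x ⊓ y = 0) : x ≤ z := by
  have := inf_add_le_inf_add_inf hy hz hx
  rw [inf_eq_left.2 h, hxy, zero_add] at this
  exact this.trans inf_le_right

theorem abs_sum_le {ι : Type*} (s : Finset ι) (x : ι → X) : |∑ i ∈ s, x i| ≤ ∑ i ∈ s, |x i| := by
  classical
  induction s using Finset.induction_on with
  | empty => simp
  | insert i s hi ih =>
    rw [Finset.sum_insert hi, Finset.sum_insert hi]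
    exact (abs_add_le _ _).trans (by gcongr)

theorem posPart_add_le (x y : X) : (x + y)⁺ ≤ x⁺ + y⁺ :=
  sup_le (add_le_add (le_posPart x) (le_posPart y))
    (add_nonneg (posPart_nonneg x) (posPart_nonneg y))

end LatticeGroup

section Module

variable {X : Type*} [AddCommGroup X] [Module ℝ X] [Lattice X] [IsOrderedModule ℝ X]

theorem smul_inf_of_nonneg {c : ℝ} (hc : 0 ≤ c) (x y : X) : c • (x ⊓ y) = c • x ⊓ c • y := by
  rcases hc.eq_or_lt with rfl | hc
  · simp
  · exact (OrderIso.smulRight (β := X) hc).map_inf x y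

theorem smul_sup_of_nonneg {c : ℝ} (hc : 0 ≤ c) (x y : X) : c • (x ⊔ y) = c • x ⊔ c • y := by
  rcases hc.eq_or_lt with rfl | hc
  · simp
  · exact (OrderIso.smulRight (β := X) hc).map_sup x y

theorem posPart_smul_of_nonneg {c : ℝ} (hc : 0 ≤ c) (x : X) : (c • x)⁺ = c • x⁺ := by
  rw [posPart_def, posPart_def, smul_sup_of_nonneg hc, smul_zero]

theorem abs_smul_eq [IsOrderedAddMonoid X] (c : ℝ) (x : X) : |c • x| = |c| • |x| := by
  have key : ∀ c : ℝ, 0 ≤ c → |c • x| = c • |x| := fun c hc => by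
    rw [abs, abs, smul_sup_of_nonneg hc, smul_neg]
  rcases le_total 0 c with hc | hc
  · rw [abs_of_nonneg hc, key c hc]
  · rw [abs_of_nonpos hc, ← key (-c) (neg_nonneg.2 hc), neg_smul, abs_neg]

end Module

/-! ### Order continuity through increasing order bounded sequences. -/

section Normed

variable {X : Type*} [NormedAddCommGroup X] [Lattice X] [IsOrderedAddMonoid X] [HasSolidNorm X]

theorem norm_le_norm_of_nonneg_of_le {x y : X} (hx : 0 ≤ x) (h : x ≤ y) : ‖x‖ ≤ ‖y‖ :=
  norm_le_norm_of_abs_le_abs (by rwa [abs_of_nonneg hx, abs_of_nonneg (hx.trans h)])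

theorem norm_le_norm_of_abs_le {x y : X} (h : |x| ≤ y) : ‖x‖ ≤ ‖y‖ := by
  rw [← norm_abs_eq_norm x]
  exact norm_le_norm_of_nonneg_of_le (abs_nonneg x) h

variable (X) in
/-- Every increasing order bounded sequence is a Cauchy sequence. -/
def MonotoneBoundedCauchy : Prop :=
  ∀ x : ℕ → X, Monotone x → BddAbove (Set.range x) → CauchySeq x

/-- A directed set that is bounded above has a supremum, which lies in its closure. -/
theorem MonotoneBoundedCauchy.exists_isLUB_mem_closure [CompleteSpace X]
    (hX : MonotoneBoundedCauchy X) {D : Set X} (hne : D.Nonempty) (hdir : DirectedOn (· ≤ ·) D)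
    (hbdd : BddAbove D) : ∃ s ∈ closure D, IsLUB D s := by
  -- Otherwise iteration inside `D` gives an increasing sequence with all steps of norm at least
  -- `ε`.
  have claim : ∀ ε : ℝ, 0 < ε → ∃ d : D, ∀ d' : D, d ≤ d' → ‖(d' : X) - d‖ < ε := by
    by_contra! hcon
    obtain ⟨ε, hε, hcon⟩ := hcon
    choose f hf hfε using hcon
    obtain ⟨d₀, hd₀⟩ := hne
    let g : ℕ → D := fun n => f^[n] ⟨d₀, hd₀⟩
    have hg : ∀ n, g (n + 1) = f (g n) := fun n => Function.iterate_succ_apply' f n _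
    have hmono : Monotone fun n => (g n : X) :=
      monotone_nat_of_le_succ fun n => by rw [hg]; exact hf (g n)
    have hc := hX _ hmono (hbdd.mono (by rintro _ ⟨n, rfl⟩; exact (g n).2))
    obtain ⟨N, hN⟩ := Metric.cauchySeq_iff'.1 hc ε hε
    have := hN (N + 1) N.le_succ
    rw [dist_eq_norm, hg] at this
    exact (hfε (g N)).not_gt this
  choose e he using fun n : ℕ => claim (1 / ((n : ℝ) + 1)) (by positivity)
  choose! j hj using hdir
  let J : D → D → D := fun a b => ⟨j a b, (hj a a.2 b b.2).1⟩
  have hJl : ∀ a b, a ≤ J a b := fun a b => (hj a a.2 b b.2).2.1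
  have hJr : ∀ a b, b ≤ J a b := fun a b => (hj a a.2 b b.2).2.2
  let d : ℕ → D := fun n => Nat.rec (e 0) (fun n a => J a (e (n + 1))) n
  have hde : ∀ n, e n ≤ d n := by
    intro n
    cases n with
    | zero => exact le_rfl
    | succ n => exact hJr _ _
  have hmono : Monotone fun n : ℕ => (d n).1 := by
    refine monotone_nat_of_le_succ fun n => ?_
    have h : d n ≤ d (n + 1) := hJl (d n) (e (n + 1))
    exact h
  have hsmall : ∀ (n : ℕ) (a : D), d n ≤ a → ‖(a : X) - (d n).1‖ ≤ 1 / ((n : ℝ) + 1) := by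
    intro n a ha
    refine (norm_le_norm_of_nonneg_of_le (sub_nonneg.2 ha) ?_).trans
      (he n a ((hde n).trans ha)).le
    have h : (e n).1 ≤ (d n).1 := hde n
    exact sub_le_sub_left h _
  obtain ⟨s, hs⟩ := cauchySeq_tendsto_of_complete
    (hX _ hmono (hbdd.mono (by rintro _ ⟨n, rfl⟩; exact (d n).2)))
  refine ⟨s, mem_closure_of_tendsto hs (Eventually.of_forall fun n => (d n).2), ?_, ?_⟩
  · intro a ha
    -- Any `a` in `D` is below the join of `a` and `d n`, which is within `1 / (n + 1)` of `d n`;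
    -- hence the joins also tend to `s`.
    have h0 : Tendsto (fun n => (J ⟨a, ha⟩ (d n)).1 - (d n).1) atTop (𝓝 0) :=
      squeeze_zero_norm (fun n => hsmall n _ (hJr _ _)) tendsto_one_div_add_atTop_nhds_zero_nat
    have h1 : Tendsto (fun n => (J ⟨a, ha⟩ (d n)).1) atTop (𝓝 s) := by
      simpa using h0.add hs
    exact ge_of_tendsto' h1 fun n => hJl ⟨a, ha⟩ (d n)
  · intro b hb
    exact le_of_tendsto' hs fun n => hb (d n).2

end Normed

section OrderContinuous

variable {X : Type u} [NormedAddCommGroup X] [Lattice X] [IsOrderedAddMonoid X] [HasSolidNorm X]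

theorem MonotoneBoundedCauchy.isOrderContinuous [CompleteSpace X]
    (hX : MonotoneBoundedCauchy X) : IsOrderContinuous X := by
  intro ι _ _ _ x hx hglb
  have hdir : DirectedOn (· ≤ ·) (Set.range fun α => -x α) := by
    rintro _ ⟨α, rfl⟩ _ ⟨β, rfl⟩
    obtain ⟨γ, hα, hβ⟩ := exists_ge_ge α β
    exact ⟨-x γ, ⟨γ, rfl⟩, neg_le_neg (hx hα), neg_le_neg (hx hβ)⟩
  have hnn : ∀ α, 0 ≤ x α := fun α => hglb.1 ⟨α, rfl⟩
  have hlub : IsLUB (Set.range fun α => -x α) 0 := by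
    refine ⟨by rintro _ ⟨α, rfl⟩; exact neg_nonpos.2 (hnn α), fun b hb => ?_⟩
    have : -b ≤ 0 := hglb.2 (by rintro _ ⟨α, rfl⟩; exact neg_le.1 (hb ⟨α, rfl⟩))
    exact neg_nonpos.1 this
  obtain ⟨s, hs, hs'⟩ := hX.exists_isLUB_mem_closure (Set.range_nonempty _) hdir ⟨0, hlub.1⟩
  rw [hs'.unique hlub] at hs
  refine Metric.tendsto_nhds.2 fun ε hε => ?_
  obtain ⟨_, ⟨α, rfl⟩, hα⟩ := Metric.mem_closure_iff.1 hs ε hε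
  filter_upwards [eventually_ge_atTop α] with β hβ
  rw [dist_zero_left, norm_neg] at hα
  rw [Real.dist_0_eq_abs, abs_norm]
  exact (norm_le_norm_of_nonneg_of_le (hnn β) (hx hβ)).trans_lt hα

/-- The differences between upper bounds and terms of the sequence decrease to `0`. One of them, `v
- x n`, therefore has small norm, and it dominates every `x m - x n` with `m ≥ n`. -/
theorem IsOrderContinuous.monotoneBoundedCauchy [NormedSpace ℝ X] [IsOrderedModule ℝ X]
    (hX : IsOrderContinuous X) : MonotoneBoundedCauchy X := by
  intro x hx hbdd
  let S : Set X := {d | ∃ v ∈ upperBounds (Set.range x), ∃ n, d = v - x n}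
  have hdir : IsDirectedOrder (Sᵒᵈ) := by
    refine ⟨fun a b => ?_⟩
    obtain ⟨v, hv, n, hn⟩ := (OrderDual.ofDual a).2
    obtain ⟨w, hw, m, hm⟩ := (OrderDual.ofDual b).2
    refine ⟨OrderDual.toDual ⟨v ⊓ w - x (max n m), v ⊓ w, fun y hy => le_inf (hv hy) (hw hy),
      _, rfl⟩, ?_, ?_⟩
    · show v ⊓ w - x (max n m) ≤ ((OrderDual.ofDual a : S) : X)
      rw [hn]
      exact sub_le_sub inf_le_left (hx (le_max_left _ _))
    · show v ⊓ w - x (max n m) ≤ ((OrderDual.ofDual b : S) : X)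
      rw [hm]
      exact sub_le_sub inf_le_right (hx (le_max_right _ _))
  obtain ⟨v₀, hv₀⟩ := hbdd
  have hne : Nonempty (Sᵒᵈ) := ⟨OrderDual.toDual ⟨v₀ - x 0, v₀, hv₀, 0, rfl⟩⟩
  have hglb : IsGLB (Set.range fun d : Sᵒᵈ => ((OrderDual.ofDual d : S) : X)) 0 := by
    constructor
    · rintro _ ⟨d, rfl⟩
      obtain ⟨v, hv, n, hn⟩ := (OrderDual.ofDual d).2
      show 0 ≤ ((OrderDual.ofDual d : S) : X)
      rw [hn]
      exact sub_nonneg.2 (hv ⟨n, rfl⟩)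
    · intro w hw
      -- A lower bound `w` of the differences can be subtracted from an upper bound again and again,
      -- so `w ≤ 0` by the Archimedean property.
      have hstep : ∀ v ∈ upperBounds (Set.range x), v - w ∈ upperBounds (Set.range x) := by
        rintro v hv _ ⟨n, rfl⟩
        have := hw ⟨OrderDual.toDual ⟨v - x n, v, hv, n, rfl⟩, rfl⟩
        exact le_sub_comm.1 this
      have hk : ∀ k : ℕ, v₀ - (k : ℝ) • w ∈ upperBounds (Set.range x) := by
        intro k
        induction k with
        | zero => simpa using hv₀
        | succ k ih =>
          have := hstep _ ih
          rwa [sub_sub, show (k : ℝ) • w + w = ((k + 1 : ℕ) : ℝ) • w by push_cast; module] at this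
      have hle : ∀ k : ℕ, w ≤ (1 / ((k : ℝ) + 1)) • (v₀ - x 0) := by
        intro k
        have h1 : ((k : ℝ) + 1) • w ≤ v₀ - x 0 := by
          have := hk (k + 1) ⟨0, rfl⟩
          push_cast at this
          exact le_sub_comm.1 this
        have hpos : (0 : ℝ) < (k : ℝ) + 1 := by positivity
        have := smul_le_smul_of_nonneg_left h1 (one_div_pos.2 hpos).le
        rwa [smul_smul, one_div_mul_cancel hpos.ne', one_smul] at this
      have hlim := (tendsto_one_div_add_atTop_nhds_zero_nat (𝕜 := ℝ)).smul_const (v₀ - x 0)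
      rw [zero_smul] at hlim
      exact ge_of_tendsto' hlim hle
  have hanti : Antitone fun d : Sᵒᵈ => ((OrderDual.ofDual d : S) : X) := fun a b h => h
  have ht := hX (Sᵒᵈ) _ hanti hglb
  rw [Metric.cauchySeq_iff']
  intro ε hε
  obtain ⟨d, hd⟩ := (ht.eventually (gt_mem_nhds hε)).exists
  obtain ⟨v, hv, n, hn⟩ := (OrderDual.ofDual d).2
  refine ⟨n, fun m hm => ?_⟩
  rw [dist_eq_norm]
  refine lt_of_le_of_lt (norm_le_norm_of_nonneg_of_le (sub_nonneg.2 (hx hm)) ?_) hd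
  rw [hn]
  exact sub_le_sub_right (hv ⟨m, rfl⟩) _

end OrderContinuous

/-! ### Weakly compact operators on `ℓ¹` from weakly null families. -/

section L1

variable {ι : Type*}

variable (ι) in
/-- The set of families of real numbers with absolute sum at most one. -/
def l1Ball : Set (ι → ℝ) := {a | ∀ F : Finset ι, ∑ i ∈ F, |a i| ≤ 1}

theorem isCompact_l1Ball : IsCompact (l1Ball ι) := by
  refine (isCompact_univ_pi fun _ : ι => isCompact_Icc (a := (-1 : ℝ)) (b := 1)).of_isClosed_subset
    ?_ ?_
  · rw [l1Ball, Set.ofPred_forall]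
    exact isClosed_iInter fun F => isClosed_le (by fun_prop) continuous_const
  · intro a ha i _
    have := ha {i}
    rw [Finset.sum_singleton] at this
    exact abs_le.1 this

theorem summable_abs_of_mem_l1Ball {a : ι → ℝ} (ha : a ∈ l1Ball ι) : Summable fun i => |a i| :=
  summable_of_sum_le (fun _ => abs_nonneg _) ha

variable {X : Type*} [NormedAddCommGroup X] [NormedSpace ℝ X] [CompleteSpace X]

theorem summable_smul_of_bounded {a : ι → ℝ} (ha : Summable fun i => |a i|) {x : ι → X} {C : ℝ}
    (hC : ∀ i, ‖x i‖ ≤ C) : Summable fun i => a i • x i := by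
  refine Summable.of_norm_bounded (ha.mul_right C) fun i => ?_
  rw [norm_smul, Real.norm_eq_abs]
  exact mul_le_mul_of_nonneg_left (hC i) (abs_nonneg _)

/-- All but finitely many `c i` are small and the absolute sum of `a` is at most one, so the finite
partial sums converge uniformly on the ball. -/
theorem continuousOn_tsum_l1Ball {c : ι → ℝ} (hc : Tendsto c cofinite (𝓝 0))
    (hs : ∀ a ∈ l1Ball ι, Summable fun i => a i * c i) :
    ContinuousOn (fun a : ι → ℝ => ∑' i, a i * c i) (l1Ball ι) := by
  classical
  refine TendstoUniformlyOn.continuousOn (F := fun (F : Finset ι) (a : ι → ℝ) => ∑ i ∈ F, a i * c i)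
    (p := atTop) ?_ (Frequently.of_forall fun F => by fun_prop)
  refine Metric.tendstoUniformlyOn_iff.2 fun ε hε => ?_
  have hfin : {i | ¬ |c i| < ε / 2}.Finite := by
    have := hc.eventually (Metric.ball_mem_nhds 0 (half_pos hε))
    simpa [Filter.eventually_cofinite] using this
  filter_upwards [eventually_ge_atTop hfin.toFinset] with F hF a ha
  rw [dist_eq_norm]
  refine lt_of_le_of_lt ?_ (half_lt_self hε)
  refine le_of_tendsto ((hs a ha).hasSum.sub_const (∑ i ∈ F, a i * c i)).norm ?_
  filter_upwards [eventually_ge_atTop F] with G hG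
  rw [← Finset.sum_sdiff hG, add_sub_cancel_right]
  calc ‖∑ i ∈ G \ F, a i * c i‖ ≤ ∑ i ∈ G \ F, |a i| * (ε / 2) := by
        refine norm_sum_le_of_le _ fun i hi => ?_
        rw [norm_mul, Real.norm_eq_abs, Real.norm_eq_abs]
        refine mul_le_mul_of_nonneg_left ?_ (abs_nonneg _)
        by_contra hcon
        exact (Finset.mem_sdiff.1 hi).2 (hF (hfin.mem_toFinset.2 fun h => hcon h.le))
    _ = (∑ i ∈ G \ F, |a i|) * (ε / 2) := by rw [Finset.sum_mul]
    _ ≤ 1 * (ε / 2) := mul_le_mul_of_nonneg_right (ha _) (half_pos hε).le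
    _ = ε / 2 := one_mul _

theorem summable_abs_lp_one (a : lp (fun _ : ι => ℝ) 1) : Summable fun i => |a i| := by
  simpa using (lp.hasSum_norm (by simp) a).summable

/-- The operator from `ℓ¹` that maps the unit vectors to a given bounded family. -/
noncomputable def l1Operator (x : ι → X) (C : ℝ) (hC : ∀ i, ‖x i‖ ≤ C) :
    lp (fun _ : ι => ℝ) 1 →L[ℝ] X :=
  LinearMap.mkContinuous
    { toFun := fun a => ∑' i, a i • x i
      map_add' := fun a b => by
        rw [← (summable_smul_of_bounded (summable_abs_lp_one a) hC).tsum_add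
          (summable_smul_of_bounded (summable_abs_lp_one b) hC)]
        simp [add_smul]
      map_smul' := fun r a => by
        rw [RingHom.id_apply, ← tsum_const_smul'']
        simp [smul_smul] }
    C fun a => by
      have h := lp.hasSum_norm (by simp) a
      simp only [ENNReal.toReal_one, Real.rpow_one] at h
      refine tsum_of_norm_bounded (h.mul_left C) fun i => ?_
      rw [norm_smul, mul_comm]
      exact mul_le_mul_of_nonneg_right (hC i) (norm_nonneg _)

theorem l1Operator_apply (x : ι → X) (C : ℝ) (hC : ∀ i, ‖x i‖ ≤ C)
    (a : lp (fun _ : ι => ℝ) 1) : l1Operator x C hC a = ∑' i, a i • x i := rfl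

theorem l1Operator_single [DecidableEq ι] (x : ι → X) (C : ℝ) (hC : ∀ i, ‖x i‖ ≤ C) (i : ι) :
    l1Operator x C hC (lp.single 1 i (1 : ℝ)) = x i := by
  rw [l1Operator_apply, tsum_eq_single i]
  · simp
  · intro j hj
    simp [lp.single_apply, hj]

/-- The operator from `ℓ¹` given by a weakly null family is weakly compact. -/
theorem isWeaklyCompactOperator_l1Operator (x : ι → X) (C : ℝ) (hC : ∀ i, ‖x i‖ ≤ C)
    (hx : ∀ g : X →L[ℝ] ℝ, Tendsto (fun i => g (x i)) cofinite (𝓝 0)) :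
    IsWeaklyCompactOperator (l1Operator x C hC) := by
  -- Pointwise convergence on the ball implies weak convergence of the sums, so the image of the
  -- ball is a weakly compact set containing that of the unit ball of `ℓ¹`.
  have hcont : ContinuousOn (fun a : ι → ℝ => toWeakSpace ℝ X (∑' i, a i • x i)) (l1Ball ι) := by
    rw [continuousOn_iff_continuous_domRestrict]
    refine WeakBilin.continuous_of_continuous_eval _ fun g => ?_
    have h := continuousOn_tsum_l1Ball (hx g) fun a ha => by
      simpa [Function.comp_def] using
        (summable_smul_of_bounded (summable_abs_of_mem_l1Ball ha) hC).map g g.continuous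
    rw [continuousOn_iff_continuous_domRestrict] at h
    convert h using 1
    funext a
    have := g.map_tsum (summable_smul_of_bounded (summable_abs_of_mem_l1Ball a.2) hC)
    simp only [map_smul, smul_eq_mul] at this
    exact this
  refine (isCompact_l1Ball.image_of_continuousOn hcont).closure_of_subset ?_
  rintro _ ⟨_, ⟨a, ha, rfl⟩, rfl⟩
  refine ⟨a, fun F => ?_, rfl⟩
  have h := lp.hasSum_norm (by simp) a
  simp only [ENNReal.toReal_one, Real.rpow_one] at h
  exact (sum_le_hasSum F (fun _ _ => norm_nonneg _) h).trans (mem_closedBall_zero_iff.1 ha)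

end L1

/-! ### Order bounded sequences under the un-compactness hypothesis. -/

section Key

variable {X : Type u} [NormedAddCommGroup X] [Lattice X] [IsOrderedAddMonoid X] [HasSolidNorm X]

/-- The test vector `u + |y|` dominates every `|x n - y|`, so truncation by it has no effect. -/
theorem tendsto_of_unTendsto_of_abs_le {x : ℕ → X} {u y : X} (hxu : ∀ n, |x n| ≤ u)
    (h : UnTendsto x atTop y) : Tendsto x atTop (𝓝 y) := by
  have hb : ∀ n, |x n - y| ≤ u + |y| := fun n => by
    rw [sub_eq_add_neg]
    exact (abs_add_le _ _).trans (by rw [abs_neg]; exact add_le_add_left (hxu n) _)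
  have := h (u + |y|) ((abs_nonneg _).trans (hb 0))
  rw [tendsto_iff_norm_sub_tendsto_zero]
  refine this.congr fun n => ?_
  rw [inf_eq_left.2 (hb n), norm_abs_eq_norm]

variable [NormedSpace ℝ X] [CompleteSpace X]

/-- If weakly compact operators into `X` are sequentially un-compact, then order bounded weakly null
sequences have norm null subsequences. -/
theorem exists_subseq_tendsto_zero
    (H : ∀ (E : Type v) [NormedAddCommGroup E] [NormedSpace ℝ E] [CompleteSpace E] (T : E →L[ℝ] X),
      IsWeaklyCompactOperator T → IsSeqUnCompactOperator T)
    {x : ℕ → X} {u : X} (hxu : ∀ n, |x n| ≤ u)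
    (hx : ∀ g : X →L[ℝ] ℝ, Tendsto (fun n => g (x n)) atTop (𝓝 0)) :
    ∃ φ : ℕ → ℕ, StrictMono φ ∧ Tendsto (x ∘ φ) atTop (𝓝 0) := by
  classical
  -- The lift places the `ℓ¹` space in the universe over which `H` quantifies.
  let z : ULift.{v} ℕ → X := fun i => x i.down
  have hC : ∀ i, ‖z i‖ ≤ ‖u‖ := fun i => norm_le_norm_of_abs_le (hxu _)
  have hz : ∀ g : X →L[ℝ] ℝ, Tendsto (fun i => g (z i)) cofinite (𝓝 0) := fun g => by
    have := hx g
    rw [← Nat.cofinite_eq_atTop] at this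
    exact this.comp (ULift.down_injective.tendsto_cofinite)
  obtain ⟨y, φ, hφ, hy⟩ := H _ _ (isWeaklyCompactOperator_l1Operator z _ hC hz) x fun n => by
    refine ⟨lp.single 1 (ULift.up n) (1 : ℝ), ?_, l1Operator_single z _ hC (ULift.up n)⟩
    rw [mem_closedBall_zero_iff, lp.norm_single (by simp)]
    simp
  have hlim := tendsto_of_unTendsto_of_abs_le (fun n => hxu (φ n)) hy
  have hy0 : y = 0 := by
    refine SeparatingDual.eq_zero_of_forall_dual_eq_zero (R := ℝ) fun g => ?_
    exact tendsto_nhds_unique ((g.continuous.tendsto y).comp hlim) ((hx g).comp hφ.tendsto_atTop)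
  exact ⟨φ, hφ, hy0 ▸ hlim⟩

end Key

section Separation

variable {X : Type u} [NormedAddCommGroup X] [NormedSpace ℝ X] [CompleteSpace X] [Lattice X]
  [IsOrderedAddMonoid X] [IsOrderedModule ℝ X] [HasSolidNorm X]

/-- If weakly compact operators into `X` are sequentially un-compact, then increasing order bounded
sequences are Cauchy. -/
theorem monotoneBoundedCauchy_of_forall_isSeqUnCompactOperator
    (H : ∀ (E : Type v) [NormedAddCommGroup E] [NormedSpace ℝ E] [CompleteSpace E] (T : E →L[ℝ] X),
      IsWeaklyCompactOperator T → IsSeqUnCompactOperator T) :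
    MonotoneBoundedCauchy X := by
  rintro x hx ⟨v, hv⟩
  by_contra hcon
  rw [Metric.cauchySeq_iff'] at hcon
  push Not at hcon
  obtain ⟨ε, hε, hcon⟩ := hcon
  choose f hf hfε using hcon
  let φ : ℕ → ℕ := fun k => f^[k] 0
  have hφ : ∀ k, φ (k + 1) = f (φ k) := fun k => Function.iterate_succ_apply' f k 0
  have hφm : Monotone φ := monotone_nat_of_le_succ fun k => by rw [hφ]; exact hf _
  let y : ℕ → X := fun k => x (φ (k + 1)) - x (φ k)
  have hy0 : ∀ k, 0 ≤ y k := fun k => sub_nonneg.2 (hx (hφm k.le_succ))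
  have hyε : ∀ k, ε ≤ ‖y k‖ := fun k => by
    have := hfε (φ k)
    rwa [← hφ, dist_eq_norm] at this
  have hsum : ∀ N, ∑ k ∈ Finset.range N, y k ≤ v - x 0 := fun N => by
    rw [Finset.sum_range_sub fun k => x (φ k)]
    exact sub_le_sub_right (hv ⟨_, rfl⟩) _
  have hyu : ∀ k, |y k| ≤ v - x 0 := fun k => by
    rw [abs_of_nonneg (hy0 k)]
    exact (Finset.single_le_sum (f := y) (fun i _ => hy0 i) (Finset.self_mem_range_succ k)).trans
      (hsum (k + 1))
  -- Sums of the increments with signs stay in the interval given by `v - x 0`; hence `∑ |g (y k)|`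
  -- is bounded.
  have hweak : ∀ g : X →L[ℝ] ℝ, Tendsto (fun k => g (y k)) atTop (𝓝 0) := fun g => by
    have hb : ∀ N, ∑ k ∈ Finset.range N, |g (y k)| ≤ ‖g‖ * ‖v - x 0‖ := fun N => by
      have h1 : ∑ k ∈ Finset.range N, |g (y k)|
          = g (∑ k ∈ Finset.range N, (SignType.sign (g (y k)) : ℝ) • y k) := by
        rw [map_sum]
        refine Finset.sum_congr rfl fun k _ => ?_
        rw [map_smul, smul_eq_mul, sign_mul_self]
      rw [h1]
      refine (le_abs_self _).trans ((g.le_opNorm _).trans ?_)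
      refine mul_le_mul_of_nonneg_left (norm_le_norm_of_abs_le ?_) (norm_nonneg _)
      refine (abs_sum_le _ _).trans ((Finset.sum_le_sum fun k _ => ?_).trans (hsum N))
      rw [abs_smul_eq, abs_of_nonneg (hy0 k)]
      have hs : |(SignType.sign (g (y k)) : ℝ)| ≤ 1 := by
        rcases SignType.sign (g (y k)) with _ | _ | _ <;> simp
      simpa using smul_le_smul_of_nonneg_right hs (hy0 k)
    have := (summable_of_sum_range_le (fun k => abs_nonneg (g (y k))) hb).tendsto_atTop_zero
    exact (tendsto_zero_iff_abs_tendsto_zero _).2 this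
  obtain ⟨ψ, -, hψ⟩ := exists_subseq_tendsto_zero H hyu hweak
  have := le_of_tendsto_of_tendsto' tendsto_const_nhds hψ.norm fun k => hyε (ψ k)
  rw [norm_zero] at this
  exact this.not_gt hε

end Separation

/-! ### Positive functionals that are strictly positive on an order interval. -/

section PositiveFunctional

theorem functional_mono {X : Type*} [NormedAddCommGroup X] [NormedSpace ℝ X] [Lattice X]
    [IsOrderedAddMonoid X] {f : X →L[ℝ] ℝ} (hf : ∀ x, 0 ≤ x → 0 ≤ f x) {x y : X} (h : x ≤ y) :
    f x ≤ f y := by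
  have := hf (y - x) (sub_nonneg.2 h)
  rw [map_sub] at this
  linarith

variable {X : Type u} [NormedAddCommGroup X] [NormedSpace ℝ X] [Lattice X]
  [IsOrderedAddMonoid X] [HasSolidNorm X]

/-- On an order interval on which `f` is strictly positive, smallness of `f` implies smallness of
the norm. -/
theorem MonotoneBoundedCauchy.exists_norm_lt [CompleteSpace X]
    (hX : MonotoneBoundedCauchy X) {u : X} {f : X →L[ℝ] ℝ} (hf : ∀ x, 0 ≤ x → 0 ≤ f x)
    (hfu : ∀ x, 0 ≤ x → x ≤ u → f x = 0 → x = 0) {ε : ℝ} (hε : 0 < ε) :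
    ∃ δ > 0, ∀ x, 0 ≤ x → x ≤ u → f x < δ → ‖x‖ < ε := by
  by_contra! hcon
  choose x hx0 hxu hfx hxε using fun n : ℕ => hcon ((1 / 2 : ℝ) ^ n) (by positivity)
  have hdir : ∀ n, DirectedOn (· ≤ ·) (Set.range fun m => partialSups (fun k => x (n + k)) m) :=
    fun n => (partialSups fun k => x (n + k)).monotone.directed_le.directedOn_range
  have hbdd : ∀ n, BddAbove (Set.range fun m => partialSups (fun k => x (n + k)) m) := fun n =>
    ⟨u, by rintro _ ⟨m, rfl⟩; exact partialSups_le _ _ _ fun k _ => hxu _⟩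
  -- `s n` is the supremum of the tail from `n`. Its value under `f` is at most a geometric tail, so
  -- the decreasing limit of `s` lies in the null set of `f` and vanishes, although `‖s n‖ ≥ ε`.
  choose s hs hlub using fun n => hX.exists_isLUB_mem_closure (Set.range_nonempty _) (hdir n)
    (hbdd n)
  have hxs : ∀ n k, x (n + k) ≤ s n := fun n k =>
    (le_partialSups (fun k => x (n + k)) k).trans ((hlub n).1 ⟨k, rfl⟩)
  have hs0 : ∀ n, 0 ≤ s n := fun n => (hx0 _).trans (hxs n 0)
  have hsu : ∀ n, s n ≤ u := fun n =>
    (hlub n).2 (by rintro _ ⟨m, rfl⟩; exact partialSups_le _ _ _ fun k _ => hxu _)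
  have hfs : ∀ n, f (s n) ≤ 2 * (1 / 2 : ℝ) ^ n := fun n => by
    have hpart : ∀ m, partialSups (fun k => x (n + k)) m ≤ ∑ k ∈ Finset.range (m + 1), x (n + k) :=
      fun m => partialSups_le _ _ _ fun k hk =>
        Finset.single_le_sum (f := fun k => x (n + k)) (fun i _ => hx0 _)
          (Finset.mem_range.2 (Nat.lt_succ_of_le hk))
    have hcl : IsClosed {y : X | f y ≤ 2 * (1 / 2 : ℝ) ^ n} :=
      isClosed_le f.continuous continuous_const
    refine closure_minimal ?_ hcl (hs n)
    rintro _ ⟨m, rfl⟩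
    refine (functional_mono hf (hpart m)).trans ?_
    rw [map_sum]
    calc ∑ k ∈ Finset.range (m + 1), f (x (n + k))
        ≤ ∑ k ∈ Finset.range (m + 1), (1 / 2 : ℝ) ^ n * (1 / 2 : ℝ) ^ k :=
          Finset.sum_le_sum fun k _ => by rw [← pow_add]; exact (hfx _).le
      _ = (1 / 2 : ℝ) ^ n * ∑ k ∈ Finset.range (m + 1), (1 / 2 : ℝ) ^ k := by rw [Finset.mul_sum]
      _ ≤ (1 / 2 : ℝ) ^ n * 2 := by
          refine mul_le_mul_of_nonneg_left ?_ (by positivity)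
          exact (Summable.sum_le_tsum _ (fun _ _ => by positivity)
            summable_geometric_two).trans tsum_geometric_two.le
      _ = 2 * (1 / 2 : ℝ) ^ n := mul_comm _ _
  have hanti : Antitone s := antitone_nat_of_succ_le fun n => (hlub (n + 1)).2 (by
    rintro _ ⟨m, rfl⟩
    refine partialSups_le _ _ _ fun k _ => ?_
    rw [add_right_comm, add_assoc]
    exact hxs n (k + 1))
  obtain ⟨t, ht⟩ := cauchySeq_tendsto_of_complete (hX (fun n => -s n) (fun a b h => neg_le_neg
    (hanti h)) ⟨0, by rintro _ ⟨n, rfl⟩; exact neg_nonpos.2 (hs0 n)⟩)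
  have hlim : Tendsto s atTop (𝓝 (-t)) := by simpa using ht.neg
  have hft : f (-t) ≤ 0 := by
    refine le_of_tendsto_of_tendsto' ((f.continuous.tendsto _).comp hlim) ?_ hfs
    simpa using (tendsto_pow_atTop_nhds_zero_of_lt_one (r := (1 / 2 : ℝ)) (by norm_num)
      (by norm_num)).const_mul 2
  have ht0 : (0 : X) ≤ -t := ge_of_tendsto' hlim hs0
  have htz := hfu (-t) ht0 (le_of_tendsto' hlim hsu) (le_antisymm hft (hf _ ht0))
  rw [htz] at hlim
  have := le_of_tendsto_of_tendsto' (tendsto_const_nhds (x := ε)) hlim.norm fun n =>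
    (hxε n).trans (norm_le_norm_of_nonneg_of_le (hx0 n) (by simpa using hxs n 0))
  rw [norm_zero] at this
  exact this.not_gt hε

variable [IsOrderedModule ℝ X]

/-- Hahn-Banach for a sublinear functional that is monotone on the positive cone. -/
theorem exists_positive_functional {u : X} (N : X → ℝ) (K : ℝ)
    (hN0 : ∀ x, 0 ≤ x → 0 ≤ N x) (hNK : ∀ x, 0 ≤ x → N x ≤ K * ‖x‖)
    (hmul : ∀ c : ℝ, 0 < c → ∀ x, 0 ≤ x → N (c • x) = c * N x)
    (hadd : ∀ x y, 0 ≤ x → 0 ≤ y → N (x + y) ≤ N x + N y)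
    (hmono : ∀ x y, 0 ≤ x → x ≤ y → N x ≤ N y) (hu : 0 ≤ u) (hu0 : u ≠ 0) :
    ∃ f : X →L[ℝ] ℝ, f u = N u ∧ (∀ x, 0 ≤ x → 0 ≤ f x) ∧ ∀ x, 0 ≤ x → f x ≤ N x := by
  have hN00 : N 0 = 0 := le_antisymm (by simpa using hNK 0 le_rfl) (hN0 0 le_rfl)
  -- Domination by `N x⁺` forces positivity: for `x ≥ 0` the bound at `-x` is `N 0 = 0`.
  obtain ⟨g, hg, hgN⟩ := exists_extension_of_le_sublinear
    (LinearPMap.mkSpanSingleton u (N u) hu0) (fun x => N x⁺)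
    (fun c hc x => by rw [posPart_smul_of_nonneg hc.le, hmul c hc _ (posPart_nonneg x)])
    (fun x y => (hmono _ _ (posPart_nonneg _) (posPart_add_le x y)).trans
      (hadd _ _ (posPart_nonneg _) (posPart_nonneg _))) (by
      rintro ⟨x, hx⟩
      obtain ⟨c, rfl⟩ := Submodule.mem_span_singleton.1 hx
      rw [show LinearPMap.mkSpanSingleton u (N u) hu0 ⟨c • u, hx⟩ = c • N u from
        LinearPMap.mkSpanSingleton'_apply _ _ _ c hx]
      rcases lt_trichotomy c 0 with hc | rfl | hc
      · exact (mul_nonpos_of_nonpos_of_nonneg hc.le (hN0 u hu)).trans (hN0 _ (posPart_nonneg _))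
      · simp [hN00]
      · show c • N u ≤ N (c • u)⁺
        rw [posPart_eq_self.2 (smul_nonneg hc.le hu), hmul c hc u hu, smul_eq_mul])
  have hle : ∀ x, 0 ≤ x → g x ≤ N x := fun x hx => by
    simpa [posPart_eq_self.2 hx] using hgN x
  have hpos : ∀ x, 0 ≤ x → 0 ≤ g x := fun x hx => by
    have := hgN (-x)
    rw [posPart_eq_zero.2 (neg_nonpos.2 hx), hN00, map_neg] at this
    linarith
  refine ⟨g.mkContinuous K fun x => ?_, ?_, hpos, hle⟩
  · have h1 : g x ≤ g |x| := by
      have := hpos (|x| - x) (sub_nonneg.2 (le_abs_self x))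
      rw [map_sub] at this
      linarith
    have h2 : -g x ≤ g |x| := by
      have := hpos (|x| + x) (by simpa using add_le_add_left (neg_le_abs x) x)
      rw [map_add] at this
      linarith
    have h3 := (hle _ (abs_nonneg x)).trans (hNK _ (abs_nonneg x))
    rw [norm_abs_eq_norm] at h3
    exact (abs_le.2 ⟨by linarith, h1⟩).trans h3
  · have := hg ⟨u, Submodule.mem_span_singleton_self u⟩
    rw [LinearMap.mkContinuous_apply, this]
    exact LinearPMap.mkSpanSingleton_apply ℝ ℝ hu0 (N u)

/-- Below every positive nonzero vector there is one on whose order interval some positive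
functional is strictly positive. -/
theorem MonotoneBoundedCauchy.exists_strictlyPositive [CompleteSpace X]
    (hX : MonotoneBoundedCauchy X) {u : X} (hu : 0 ≤ u) (hu0 : u ≠ 0) :
    ∃ w, 0 ≤ w ∧ w ≤ u ∧ w ≠ 0 ∧ ∃ f : X →L[ℝ] ℝ, (∀ x, 0 ≤ x → 0 ≤ f x) ∧
      ∀ x, 0 ≤ x → x ≤ w → f x = 0 → x = 0 := by
  obtain ⟨f, hfu, hf, -⟩ := exists_positive_functional (u := u) (fun x => ‖x‖) 1
    (fun x _ => norm_nonneg x) (fun x _ => (one_mul _).ge)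
    (fun c hc x _ => by rw [norm_smul, Real.norm_of_nonneg hc.le]) (fun x y _ _ => norm_add_le x y)
    (fun x y hx h => norm_le_norm_of_nonneg_of_le hx h) hu hu0
  -- The null set of `f` in `[0, u]` has a largest element `s`, and `w = u - s` works: a null vector
  -- below `w` could be added to `s`. Since `f u = ‖u‖`, `s` is not `u`.
  let D : Set X := {x | 0 ≤ x ∧ x ≤ u ∧ f x = 0}
  have hdir : DirectedOn (· ≤ ·) D := by
    rintro x ⟨hx, hxu, hfx⟩ y ⟨hy, hyu, hfy⟩
    refine ⟨x ⊔ y, ⟨hx.trans le_sup_left, sup_le hxu hyu, ?_⟩, le_sup_left, le_sup_right⟩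
    refine le_antisymm ?_ (hf _ (hx.trans le_sup_left))
    have := functional_mono hf (sup_le (le_add_of_nonneg_right hy) (le_add_of_nonneg_left hx))
    rw [map_add, hfx, hfy, add_zero] at this
    exact this
  have hclosed : IsClosed D :=
    (isClosed_le continuous_const continuous_id).inter
      ((isClosed_le continuous_id continuous_const).inter
        (isClosed_eq f.continuous continuous_const))
  obtain ⟨s, hs, hlub⟩ := hX.exists_isLUB_mem_closure (D := D) ⟨0, le_rfl, hu, map_zero f⟩ hdir
    ⟨u, fun x hx => hx.2.1⟩
  rw [hclosed.closure_eq] at hs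
  obtain ⟨hs0, hsu, hfs⟩ := hs
  refine ⟨u - s, sub_nonneg.2 hsu, sub_le_self _ hs0, fun h => ?_, f, hf, fun x hx hxw hfx => ?_⟩
  · rw [sub_eq_zero.1 h, hfs] at hfu
    exact hu0 (norm_eq_zero.1 (by rw [sub_eq_zero.1 h]; exact hfu.symm))
  · have : x + s ≤ s := hlub.1 ⟨add_nonneg hx hs0, le_sub_iff_add_le.1 hxw, by
      rw [map_add, hfx, hfs, add_zero]⟩
    exact le_antisymm (by simpa using this) hx

end PositiveFunctional

/-! ### Components and band projections. -/

section Component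

/-- `q` is a component of `p`. -/
structure IsComponent {X : Type*} [AddCommGroup X] [Lattice X] (q p : X) : Prop where
  nonneg : 0 ≤ q
  le : q ≤ p
  inf_sub : q ⊓ (p - q) = 0

variable {X : Type u} [AddCommGroup X] [Lattice X] [IsOrderedAddMonoid X]

theorem IsComponent.trans {q p w : X} (hq : IsComponent q p) (hp : IsComponent p w) :
    IsComponent q w := by
  refine ⟨hq.nonneg, hq.le.trans hp.le, ?_⟩
  have h1 := sub_nonneg.2 hq.le
  have h2 := sub_nonneg.2 hp.le
  have h3 := inf_eq_zero_of_le hq.nonneg h2 hq.le le_rfl hp.inf_sub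
  have := add_inf_eq_zero h1 h2 hq.nonneg (by rw [inf_comm, hq.inf_sub]) (by rw [inf_comm, h3])
  rwa [sub_add_sub_comm, add_comm q p, add_sub_add_left_eq_sub, inf_comm] at this

theorem IsComponent.add {q z p : X} (hq : IsComponent q p) (hz : IsComponent z (p - q)) :
    IsComponent (q + z) p := by
  have h0 : 0 ≤ p - (q + z) := by rw [← sub_sub]; exact sub_nonneg.2 hz.le
  refine ⟨add_nonneg hq.nonneg hz.nonneg, sub_nonneg.1 h0, ?_⟩
  refine add_inf_eq_zero hq.nonneg hz.nonneg h0 ?_ ?_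
  · refine inf_eq_zero_of_le hq.nonneg h0 le_rfl ?_ hq.inf_sub
    exact sub_le_sub_left (le_add_of_nonneg_right hz.nonneg) _
  · rw [← sub_sub]
    exact hz.inf_sub

theorem IsComponent.sub_self {q p : X} (hq : IsComponent q p) : IsComponent (p - q) p :=
  ⟨sub_nonneg.2 hq.le, sub_le_self _ hq.nonneg, by
    rw [sub_sub_cancel, inf_comm, hq.inf_sub]⟩

end Component

section Projection

variable {X : Type u} [NormedAddCommGroup X] [Lattice X]
  [IsOrderedAddMonoid X] [HasSolidNorm X] [CompleteSpace X]

/-- The component of `p` in the band generated by `y`. -/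
theorem MonotoneBoundedCauchy.exists_isComponent (hX : MonotoneBoundedCauchy X) {p y z : X}
    (hp : 0 ≤ p) (hy : 0 ≤ y) (hz : 0 ≤ z) (hyz : y ⊓ z = 0) :
    ∃ q, IsComponent q p ∧ p ⊓ y ≤ q ∧ q ⊓ z = 0 := by
  have hmono : Monotone fun n : ℕ => p ⊓ n • y := fun m n h =>
    inf_le_inf_left _ (nsmul_le_nsmul_left hy h)
  obtain ⟨q, hq, hlub⟩ := hX.exists_isLUB_mem_closure (Set.range_nonempty fun n : ℕ => p ⊓ n • y)
    hmono.directed_le.directedOn_range ⟨p, by rintro _ ⟨n, rfl⟩; exact inf_le_left⟩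
  have hle : ∀ n : ℕ, p ⊓ n • y ≤ q := fun n => hlub.1 ⟨n, rfl⟩
  have hq0 : 0 ≤ q := (le_inf hp (by simp)).trans (hle 0)
  have hqp : q ≤ p := hlub.2 (by rintro _ ⟨n, rfl⟩; exact inf_le_left)
  have key : ∀ w, (∀ n : ℕ, (p ⊓ n • y) ⊓ w = 0) → q ⊓ w = 0 := fun w hw => by
    have hcl : IsClosed {x : X | x ⊓ w = 0} :=
      isClosed_eq (continuous_id.inf continuous_const) continuous_const
    exact closure_minimal (by rintro _ ⟨n, rfl⟩; exact hw n) hcl hq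
  have hn : ∀ w, 0 ≤ w → y ⊓ w = 0 → ∀ n : ℕ, (p ⊓ n • y) ⊓ w = 0 := fun w hw hyw n => by
    have : (n • y) ⊓ w = 0 := by
      induction n with
      | zero => simpa using hw
      | succ n ih => rw [succ_nsmul]; exact add_inf_eq_zero (nsmul_nonneg hy n) hy hw ih hyw
    exact inf_eq_zero_of_le (le_inf hp (nsmul_nonneg hy n)) hw inf_le_right le_rfl this
  have hpq : 0 ≤ p - q := sub_nonneg.2 hqp
  refine ⟨q, ⟨hq0, hqp, key _ (hn _ hpq ?_)⟩, by simpa using hle 1, key _ (hn _ hz hyz)⟩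
  -- Adding `y ⊓ (p - q)` to `p ⊓ n • y` stays below `p ⊓ (n + 1) • y`, hence below `q`.
  have he : q ≤ q - y ⊓ (p - q) := by
    refine hlub.2 ?_
    rintro _ ⟨n, rfl⟩
    refine le_sub_iff_add_le.2 (le_trans (le_inf ?_ ?_) (hle (n + 1)))
    · calc p ⊓ n • y + y ⊓ (p - q) ≤ q + (p - q) := add_le_add (hle n) inf_le_right
        _ = p := add_sub_cancel _ _
    · rw [succ_nsmul]
      exact add_le_add inf_le_right inf_le_left
  exact le_antisymm (by simpa using he) (le_inf hy hpq)

end Projection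

/-! ### Halving components in the absence of atoms. -/

section Halving

variable {X : Type u} [NormedAddCommGroup X] [NormedSpace ℝ X] [Lattice X]
  [IsOrderedAddMonoid X] [IsOrderedModule ℝ X]

theorem exists_notMem_span_of_not_isAtomVector {p : X} (hp : 0 ≤ p) (hp0 : p ≠ 0)
    (h : ¬ IsAtomVector p) : ∃ z, 0 ≤ z ∧ z ≤ p ∧ z ∉ Submodule.span ℝ {p} := by
  by_contra! hcon
  refine h ⟨hp, hp0, Set.Subset.antisymm ?_ ?_⟩
  · rintro x ⟨c, hc, hx⟩
    rw [abs_of_nonneg hp] at hx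
    have key : ∀ y, 0 ≤ y → y ≤ |x| → y ∈ Submodule.span ℝ {p} := fun y hy hyx => by
      rcases hc.eq_or_lt with rfl | hc
      · rw [zero_smul] at hx
        rw [le_antisymm (hyx.trans hx) hy]
        exact zero_mem _
      · have h1 := smul_le_smul_of_nonneg_left (hyx.trans hx) (inv_pos.2 hc).le
        rw [inv_smul_smul₀ hc.ne'] at h1
        have := Submodule.smul_mem _ c (hcon _ (smul_nonneg (inv_pos.2 hc).le hy) h1)
        rwa [smul_inv_smul₀ hc.ne'] at this
    rw [← posPart_sub_negPart x]
    exact sub_mem (key _ (posPart_nonneg x) (sup_le (le_abs_self x) (abs_nonneg x)))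
      (key _ (negPart_nonneg x) (sup_le (neg_le_abs x) (abs_nonneg x)))
  · intro x hx
    obtain ⟨c, rfl⟩ := Submodule.mem_span_singleton.1 hx
    exact ⟨|c|, abs_nonneg c, (abs_smul_eq c p).le⟩

variable [HasSolidNorm X] [CompleteSpace X]

/-- Subtract from some `z` in `[0, p]` off the line of `p` the multiple of `p` with the same
`f`-value. The difference `d` is nonzero with `f d = 0`, so strict positivity makes `d⁺` and `d⁻`
both nonzero; the component of `p` generated by `d⁺` separates them. -/
theorem MonotoneBoundedCauchy.exists_split (hX : MonotoneBoundedCauchy X) {u : X}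
    {f : X →L[ℝ] ℝ} (hf : ∀ x, 0 ≤ x → 0 ≤ f x) (hfu : ∀ x, 0 ≤ x → x ≤ u → f x = 0 → x = 0)
    (hu : ∀ a, IsAtomVector a → ¬ a ≤ u) {p : X} (hp : 0 ≤ p) (hp0 : p ≠ 0) (hpu : p ≤ u) :
    ∃ q, IsComponent q p ∧ q ≠ 0 ∧ p - q ≠ 0 := by
  obtain ⟨z, hz, hzp, hzs⟩ := exists_notMem_span_of_not_isAtomVector hp hp0 fun h => hu p h hpu
  have hfp : 0 < f p := lt_of_le_of_ne (hf p hp) fun h => hp0 (hfu p hp hpu h.symm)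
  have ht0 : 0 ≤ f z / f p := div_nonneg (hf z hz) hfp.le
  have ht1 : f z / f p ≤ 1 := (div_le_one hfp).2 (functional_mono hf hzp)
  set t := f z / f p with ht
  have htp : t • p ≤ p := by simpa using smul_le_smul_of_nonneg_right ht1 hp
  set d := z - t • p with hd
  have hfd : f d = 0 := by
    rw [hd, map_sub, map_smul, smul_eq_mul, ht, div_mul_cancel₀ _ hfp.ne', sub_self]
  have hd0 : d ≠ 0 := fun h => hzs (by
    rw [sub_eq_zero.1 h]
    exact Submodule.smul_mem _ _ (Submodule.mem_span_singleton_self p))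
  have hdz : d ≤ z := sub_le_self _ (smul_nonneg ht0 hp)
  have hdt : -d ≤ t • p := by rw [hd, neg_sub]; exact sub_le_self _ hz
  have hpos : d⁺ ≠ 0 := fun h => by
    have h0 : 0 ≤ -d := neg_nonneg.2 (posPart_eq_zero.1 h)
    exact hd0 (neg_eq_zero.1 (hfu (-d) h0 (hdt.trans (htp.trans hpu))
      (by rw [map_neg, hfd, neg_zero])))
  have hneg : d⁻ ≠ 0 := fun h =>
    hd0 (hfu d (negPart_eq_zero.1 h) (hdz.trans (hzp.trans hpu)) hfd)
  have hdp : d⁺ ≤ p := (sup_le hdz hz).trans hzp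
  have hdn : d⁻ ≤ p := (sup_le hdt (smul_nonneg ht0 hp)).trans htp
  obtain ⟨q, hq, hdq, hqd⟩ := hX.exists_isComponent hp (posPart_nonneg d) (negPart_nonneg d)
    (posPart_inf_negPart_eq_zero d)
  rw [inf_eq_right.2 hdp] at hdq
  refine ⟨q, hq, fun h => ?_, fun h => ?_⟩
  · exact hpos (le_antisymm (h ▸ hdq) (posPart_nonneg d))
  · have := le_of_le_add_of_inf_eq_zero (negPart_nonneg d) hq.nonneg (sub_nonneg.2 hq.le)
      (by rwa [add_sub_cancel]) (by rw [inf_comm, hqd])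
    exact hneg (le_antisymm (this.trans h.le) (negPart_nonneg d))

theorem MonotoneBoundedCauchy.exists_small_component (hX : MonotoneBoundedCauchy X) {u : X}
    {f : X →L[ℝ] ℝ} (hf : ∀ x, 0 ≤ x → 0 ≤ f x) (hfu : ∀ x, 0 ≤ x → x ≤ u → f x = 0 → x = 0)
    (hu : ∀ a, IsAtomVector a → ¬ a ≤ u) (n : ℕ) {p : X} (hp : 0 ≤ p) (hp0 : p ≠ 0)
    (hpu : p ≤ u) : ∃ q, IsComponent q p ∧ q ≠ 0 ∧ f q ≤ (1 / 2) ^ n * f p := by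
  induction n with
  | zero => exact ⟨p, ⟨hp, le_rfl, by simpa using hp⟩, hp0, by simp⟩
  | succ n ih =>
    obtain ⟨q, hq, hq0, hfq⟩ := ih
    obtain ⟨r, hr, hr0, hr1⟩ := hX.exists_split hf hfu hu hq.nonneg hq0 (hq.le.trans hpu)
    have hsum : f r + f (q - r) = f q := by rw [map_sub]; ring
    have hstep : (1 / 2 : ℝ) ^ (n + 1) * f p = (1 / 2) * ((1 / 2) ^ n * f p) := by ring
    rcases le_total (f r) (f (q - r)) with h | h
    · exact ⟨r, hr.trans hq, hr0, by rw [hstep]; linarith⟩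
    · exact ⟨q - r, hr.sub_self.trans hq, hr1, by rw [hstep]; linarith⟩

/-- Zorn's lemma gives a maximal component with `f`-value at most half. If the value were smaller, a
nonzero component of `p - q` with tiny `f`-value could still be added. -/
theorem MonotoneBoundedCauchy.exists_half (hX : MonotoneBoundedCauchy X) {u : X}
    {f : X →L[ℝ] ℝ} (hf : ∀ x, 0 ≤ x → 0 ≤ f x) (hfu : ∀ x, 0 ≤ x → x ≤ u → f x = 0 → x = 0)
    (hu : ∀ a, IsAtomVector a → ¬ a ≤ u) {p : X} (hp : 0 ≤ p) (hpu : p ≤ u) :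
    ∃ q, IsComponent q p ∧ f q = f p / 2 := by
  let S : Set X := {q | 0 ≤ q ∧ q ≤ p ∧ q ⊓ (p - q) = 0 ∧ f q ≤ f p / 2}
  have hclosed : IsClosed S :=
    (isClosed_le continuous_const continuous_id).inter
      ((isClosed_le continuous_id continuous_const).inter
        ((isClosed_eq (continuous_id.inf (continuous_const.sub continuous_id))
          continuous_const).inter (isClosed_le f.continuous continuous_const)))
  have h0 : (0 : X) ∈ S := ⟨le_rfl, hp, by simpa using hp, by
    rw [map_zero]; exact div_nonneg (hf p hp) two_pos.le⟩
  obtain ⟨q, -, hq⟩ := zorn_le_nonempty₀ S (fun c hc hchain y hy => by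
    obtain ⟨s, hs, hlub⟩ := hX.exists_isLUB_mem_closure ⟨y, hy⟩ hchain.directedOn
      ⟨p, fun x hx => (hc hx).2.1⟩
    exact ⟨s, closure_minimal hc hclosed hs, hlub.1⟩) 0 h0
  have hqc : IsComponent q p := ⟨hq.prop.1, hq.prop.2.1, hq.prop.2.2.1⟩
  refine ⟨q, hqc, le_antisymm hq.prop.2.2.2 (not_lt.1 fun hlt => ?_)⟩
  have hpq : p - q ≠ 0 := fun h => by
    rw [← sub_eq_zero.1 h] at hlt
    linarith [hf p hp]
  -- The denominator `f p + 1` is positive even when `f p = 0`, and it bounds `f (p - q)`.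
  obtain ⟨n, hn⟩ := exists_pow_lt_of_lt_one (x := (f p / 2 - f q) / (f p + 1))
    (div_pos (sub_pos.2 hlt) (by linarith [hf p hp])) (show (1 / 2 : ℝ) < 1 by norm_num)
  obtain ⟨z, hz, hz0, hfz⟩ := hX.exists_small_component hf hfu hu n (sub_nonneg.2 hqc.le) hpq
    ((sub_le_self _ hqc.nonneg).trans hpu)
  have hfz' : f z ≤ f p / 2 - f q := by
    have h1 : f (p - q) ≤ f p + 1 := by
      rw [map_sub]; linarith [hf q hqc.nonneg]
    rw [lt_div_iff₀ (by linarith [hf p hp])] at hn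
    exact hfz.trans ((mul_le_mul_of_nonneg_left h1 (by positivity)).trans hn.le)
  have hadd := hqc.add hz
  have := hq.le_of_ge (y := q + z) ⟨hadd.nonneg, hadd.le, hadd.inf_sub, by
    rw [map_add]; linarith⟩ (le_add_of_nonneg_right hz.nonneg)
  exact hz0 (le_antisymm (by simpa using this) hz.nonneg)

end Halving

theorem sum_range_two_mul {M : Type*} [AddCommMonoid M] (g : ℕ → M) (m : ℕ) :
    ∑ k ∈ Finset.range (2 * m), g k = ∑ k ∈ Finset.range m, (g (2 * k) + g (2 * k + 1)) := by
  induction m with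
  | zero => simp
  | succ m ih =>
    rw [show 2 * (m + 1) = 2 * m + 1 + 1 by ring, Finset.sum_range_succ, Finset.sum_range_succ, ih,
      Finset.sum_range_succ, add_assoc]

/-! ### Dyadic trees and Rademacher vectors. -/

section Dyadic

variable {X : Type u} [AddCommGroup X]

/-- The dyadic tree that arises from `u` by iterated splitting of `p` into `h p` and `p - h p`. -/
def dyadicTree (h : X → X) (u : X) : ℕ → ℕ → X
  | 0, k => if k = 0 then u else 0
  | n + 1, k =>
    if k % 2 = 0 then h (dyadicTree h u n (k / 2))
    else dyadicTree h u n (k / 2) - h (dyadicTree h u n (k / 2))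

theorem dyadicTree_succ_even (h : X → X) (u : X) (n k : ℕ) :
    dyadicTree h u (n + 1) (2 * k) = h (dyadicTree h u n k) := by
  simp [dyadicTree]

theorem dyadicTree_succ_odd (h : X → X) (u : X) (n k : ℕ) :
    dyadicTree h u (n + 1) (2 * k + 1) = dyadicTree h u n k - h (dyadicTree h u n k) := by
  have h1 : (2 * k + 1) / 2 = k := by omega
  have h2 : (2 * k + 1) % 2 = 1 := by omega
  simp [dyadicTree, h1, h2]

theorem sum_dyadicTree (h : X → X) (u : X) (n : ℕ) :
    ∑ k ∈ Finset.range (2 ^ n), dyadicTree h u n k = u := by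
  induction n with
  | zero => simp [dyadicTree]
  | succ n ih =>
    rw [pow_succ', sum_range_two_mul]
    simpa only [dyadicTree_succ_even, dyadicTree_succ_odd, add_sub_cancel] using ih

/-- The Rademacher vectors of the dyadic tree. -/
def rademacher (h : X → X) (u : X) (n : ℕ) : X :=
  ∑ k ∈ Finset.range (2 ^ n), (dyadicTree h u (n + 1) (2 * k) - dyadicTree h u (n + 1) (2 * k + 1))

/-- This is the orthogonality of Rademacher functions: passing to the next level replaces each
coefficient `C` by `C + c N` and `C - c N`, whose squares add up to `2 C² + 2 (c N)²`. -/
theorem exists_sum_smul_rademacher_eq [Module ℝ X] (h : X → X) (u : X) (c : ℕ → ℝ) (N : ℕ) :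
    ∃ C : ℕ → ℝ,
      ∑ n ∈ Finset.range N, c n • rademacher h u n
        = ∑ k ∈ Finset.range (2 ^ N), C k • dyadicTree h u N k ∧
      ∑ k ∈ Finset.range (2 ^ N), C k ^ 2 = 2 ^ N * ∑ n ∈ Finset.range N, c n ^ 2 := by
  induction N with
  | zero => exact ⟨fun _ => 0, by simp, by simp⟩
  | succ N ih =>
    obtain ⟨C, hC, hC2⟩ := ih
    let D : ℕ → ℝ := fun k => if k % 2 = 0 then C (k / 2) + c N else C (k / 2) - c N
    have hDe : ∀ k, D (2 * k) = C k + c N := fun k => by simp [D]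
    have hDo : ∀ k, D (2 * k + 1) = C k - c N := fun k => by
      have h1 : (2 * k + 1) / 2 = k := by omega
      have h2 : (2 * k + 1) % 2 = 1 := by omega
      simp [D, h1, h2]
    refine ⟨D, ?_, ?_⟩
    · rw [Finset.sum_range_succ, hC, rademacher, Finset.smul_sum, ← Finset.sum_add_distrib,
        pow_succ' 2 N, sum_range_two_mul]
      refine Finset.sum_congr rfl fun k _ => ?_
      rw [hDe, hDo, dyadicTree_succ_even, dyadicTree_succ_odd]
      module
    · rw [pow_succ' 2 N, sum_range_two_mul, Finset.sum_range_succ]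
      have : ∀ k, D (2 * k) ^ 2 + D (2 * k + 1) ^ 2 = 2 * C k ^ 2 + 2 * c N ^ 2 := fun k => by
        rw [hDe, hDo]; ring
      simp only [this]
      rw [Finset.sum_add_distrib, ← Finset.mul_sum, hC2, Finset.sum_const, Finset.card_range,
        nsmul_eq_mul]
      push_cast
      ring

variable [Lattice X] [IsOrderedAddMonoid X]

theorem dyadicTree_mem_Icc {h : X → X} {u : X} (hu : 0 ≤ u)
    (hh : ∀ p, 0 ≤ p → p ≤ u → IsComponent (h p) p) (n k : ℕ) :
    0 ≤ dyadicTree h u n k ∧ dyadicTree h u n k ≤ u := by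
  induction n generalizing k with
  | zero => by_cases hk : k = 0 <;> simp [dyadicTree, hk, hu]
  | succ n ih =>
    obtain ⟨h0, h1⟩ := ih (k / 2)
    have hc := hh _ h0 h1
    rw [dyadicTree]
    split_ifs
    · exact ⟨hc.nonneg, hc.le.trans h1⟩
    · exact ⟨sub_nonneg.2 hc.le, (sub_le_self _ hc.nonneg).trans h1⟩

/-- Siblings are complementary components of their parent; other nodes of a level lie below
distinct, hence disjoint, parents. -/
theorem dyadicTree_inf_eq_zero {h : X → X} {u : X} (hu : 0 ≤ u)
    (hh : ∀ p, 0 ≤ p → p ≤ u → IsComponent (h p) p) (n : ℕ) {j k : ℕ} (hjk : j ≠ k) :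
    dyadicTree h u n j ⊓ dyadicTree h u n k = 0 := by
  induction n generalizing j k with
  | zero =>
    by_cases hj : j = 0
    · have hk : k ≠ 0 := fun hk => hjk (hj.trans hk.symm)
      simp [dyadicTree, hj, hk, hu]
    · by_cases hk : k = 0 <;> simp [dyadicTree, hj, hk, hu]
  | succ n ih =>
    have hle : ∀ i, dyadicTree h u (n + 1) i ≤ dyadicTree h u n (i / 2) := fun i => by
      obtain ⟨h0, h1⟩ := dyadicTree_mem_Icc hu hh n (i / 2)
      have hc := hh _ h0 h1
      rw [dyadicTree]
      split_ifs
      · exact hc.le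
      · exact sub_le_self _ hc.nonneg
    by_cases hd : j / 2 = k / 2
    · obtain ⟨h0, h1⟩ := dyadicTree_mem_Icc hu hh n (k / 2)
      have hc := hh _ h0 h1
      rw [dyadicTree, dyadicTree, hd]
      split_ifs with h2 h3 h3
      · omega
      · exact hc.inf_sub
      · rw [inf_comm]; exact hc.inf_sub
      · omega
    · exact inf_eq_zero_of_le (dyadicTree_mem_Icc hu hh _ _).1 (dyadicTree_mem_Icc hu hh _ _).1
        (hle j) (hle k) (ih hd)

theorem abs_rademacher {h : X → X} {u : X} (hu : 0 ≤ u)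
    (hh : ∀ p, 0 ≤ p → p ≤ u → IsComponent (h p) p) (n : ℕ) : |rademacher h u n| = u := by
  have h0 : ∀ k, 0 ≤ dyadicTree h u (n + 1) k := fun k => (dyadicTree_mem_Icc hu hh _ _).1
  rw [rademacher, Finset.sum_sub_distrib, abs_sub_eq_add_of_inf_eq_zero, ← Finset.sum_add_distrib,
    ← sum_range_two_mul (fun k => dyadicTree h u (n + 1) k), ← pow_succ', sum_dyadicTree]
  refine sum_inf_eq_zero _ (fun _ _ => h0 _) (Finset.sum_nonneg fun _ _ => h0 _) fun i _ => ?_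
  rw [inf_comm]
  refine sum_inf_eq_zero _ (fun _ _ => h0 _) (h0 _) fun j _ => ?_
  exact dyadicTree_inf_eq_zero hu hh _ (by omega)

end Dyadic

section Weak

variable {X : Type u} [NormedAddCommGroup X] [NormedSpace ℝ X] [Lattice X]
  [IsOrderedAddMonoid X]

theorem functional_dyadicTree_le {h : X → X} {u : X} (hu : 0 ≤ u) {f : X →L[ℝ] ℝ}
    (hf : ∀ x, 0 ≤ x → 0 ≤ f x) (hh : ∀ p, 0 ≤ p → p ≤ u → IsComponent (h p) p)
    (hfh : ∀ p, 0 ≤ p → p ≤ u → f (h p) = f p / 2) (n k : ℕ) :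
    f (dyadicTree h u n k) ≤ f u / 2 ^ n := by
  induction n generalizing k with
  | zero => by_cases hk : k = 0 <;> simp [dyadicTree, hk, hf u hu]
  | succ n ih =>
    obtain ⟨h0, h1⟩ := dyadicTree_mem_Icc hu hh n (k / 2)
    have hk := ih (k / 2)
    have hs : f u / 2 ^ (n + 1) = f u / 2 ^ n / 2 := by rw [pow_succ, div_div]
    rw [dyadicTree, hs]
    split_ifs
    · rw [hfh _ h0 h1]; linarith
    · rw [map_sub, hfh _ h0 h1]; linarith

variable [IsOrderedModule ℝ X]

/-- The Cauchy–Schwarz inequality over the `2 ^ N` nodes of level `N`, each of `f`-value at most `f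
u / 2 ^ N`, bounds the `L¹` norm by the `L²` norm. -/
theorem functional_abs_sum_rademacher_le {h : X → X} {u : X} (hu : 0 ≤ u) {f : X →L[ℝ] ℝ}
    (hf : ∀ x, 0 ≤ x → 0 ≤ f x) (hh : ∀ p, 0 ≤ p → p ≤ u → IsComponent (h p) p)
    (hfh : ∀ p, 0 ≤ p → p ≤ u → f (h p) = f p / 2) (c : ℕ → ℝ) (N : ℕ) :
    f |∑ n ∈ Finset.range N, c n • rademacher h u n|
      ≤ f u * √(∑ n ∈ Finset.range N, c n ^ 2) := by
  obtain ⟨C, hC, hC2⟩ := exists_sum_smul_rademacher_eq h u c N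
  have hfu := hf u hu
  have h2 : (0 : ℝ) < 2 ^ N := by positivity
  rw [hC]
  have h1 : f |∑ k ∈ Finset.range (2 ^ N), C k • dyadicTree h u N k|
      ≤ ∑ k ∈ Finset.range (2 ^ N), |C k| * (f u / 2 ^ N) := by
    refine (functional_mono hf (abs_sum_le _ _)).trans ?_
    rw [map_sum]
    refine Finset.sum_le_sum fun k _ => ?_
    rw [abs_smul_eq, abs_of_nonneg (dyadicTree_mem_Icc hu hh N k).1, map_smul, smul_eq_mul]
    exact mul_le_mul_of_nonneg_left (functional_dyadicTree_le hu hf hh hfh N k) (abs_nonneg _)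
  have hcs : (∑ k ∈ Finset.range (2 ^ N), |C k|) ≤ 2 ^ N * √(∑ n ∈ Finset.range N, c n ^ 2) := by
    have := sq_sum_le_card_mul_sum_sq (s := Finset.range (2 ^ N)) (f := fun k => |C k|)
    simp only [sq_abs, hC2, Finset.card_range] at this
    refine le_trans (Real.le_sqrt_of_sq_le this) ?_
    push_cast
    rw [← mul_assoc, Real.sqrt_mul (by positivity), Real.sqrt_mul_self h2.le]
  refine h1.trans ?_
  rw [← Finset.sum_mul]
  calc _ ≤ (2 ^ N * √(∑ n ∈ Finset.range N, c n ^ 2)) * (f u / 2 ^ N) :=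
        mul_le_mul_of_nonneg_right hcs (by positivity)
    _ = _ := by field_simp

variable [HasSolidNorm X] [CompleteSpace X]

/-- If `|g|` were at least `ε` on infinitely many Rademacher vectors, a signed average `x` of `M` of
them would satisfy `g x ≥ ε` and `|x| ≤ u`, while `f |x| ≤ f u / √M`. For large `M` this makes `‖x‖`
too small. -/
theorem MonotoneBoundedCauchy.tendsto_functional_rademacher (hX : MonotoneBoundedCauchy X)
    {h : X → X} {u : X} (hu : 0 ≤ u) {f : X →L[ℝ] ℝ}
    (hf : ∀ x, 0 ≤ x → 0 ≤ f x) (hfu : ∀ x, 0 ≤ x → x ≤ u → f x = 0 → x = 0)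
    (hh : ∀ p, 0 ≤ p → p ≤ u → IsComponent (h p) p)
    (hfh : ∀ p, 0 ≤ p → p ≤ u → f (h p) = f p / 2) (g : X →L[ℝ] ℝ) :
    Tendsto (fun n => g (rademacher h u n)) atTop (𝓝 0) := by
  classical
  rw [Metric.tendsto_nhds]
  by_contra! hcon
  obtain ⟨ε, hε, hcon⟩ := hcon
  rw [← Nat.cofinite_eq_atTop, Filter.frequently_cofinite_iff_infinite] at hcon
  obtain ⟨δ, hδ, hsmall⟩ := hX.exists_norm_lt hf hfu
    (div_pos hε (show 0 < ‖g‖ + 1 by positivity))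
  obtain ⟨M, hM⟩ := exists_nat_gt (max 1 ((f u / δ) ^ 2))
  have hM1 : (1 : ℝ) < M := (le_max_left _ _).trans_lt hM
  have hM0 : (0 : ℝ) < M := one_pos.trans hM1
  obtain ⟨s, hs, hsM⟩ := Set.Infinite.exists_subset_card_eq hcon M
  let N := s.sup id + 1
  have hsN : s ⊆ Finset.range N := fun n hn =>
    Finset.mem_range.2 (Nat.lt_succ_of_le (Finset.le_sup (f := id) hn))
  let c : ℕ → ℝ := fun n => if n ∈ s then SignType.sign (g (rademacher h u n)) / M else 0
  have hc : ∀ n, |c n| ≤ if n ∈ s then 1 / (M : ℝ) else 0 := fun n => by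
    by_cases hn : n ∈ s
    · simp only [c, hn, if_true, abs_div, abs_of_pos hM0]
      refine div_le_div_of_nonneg_right ?_ hM0.le
      rcases SignType.sign (g (rademacher h u n)) with _ | _ | _ <;> simp
    · simp [c, hn]
  have hsum : ∀ a : ℝ, ∑ n ∈ Finset.range N, (if n ∈ s then a else 0) = M * a := fun a => by
    rw [← Finset.sum_filter, Finset.filter_mem_eq_inter, Finset.inter_eq_right.2 hsN,
      Finset.sum_const, hsM, nsmul_eq_mul]
  set x := ∑ n ∈ Finset.range N, c n • rademacher h u n with hx
  have hxu : |x| ≤ u := by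
    refine (abs_sum_le _ _).trans ?_
    simp only [abs_smul_eq, abs_rademacher hu hh]
    rw [← Finset.sum_smul]
    have : ∑ n ∈ Finset.range N, |c n| ≤ 1 := (Finset.sum_le_sum fun n _ => hc n).trans (by
      rw [hsum, mul_one_div_cancel hM0.ne'])
    simpa using smul_le_smul_of_nonneg_right this hu
  have hc2 : ∑ n ∈ Finset.range N, c n ^ 2 ≤ 1 / M := by
    have : ∀ n, c n ^ 2 ≤ if n ∈ s then (1 / (M : ℝ)) ^ 2 else 0 := fun n => by
      have h1 := hc n
      rw [← sq_abs]
      split_ifs at h1 ⊢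
      · exact pow_le_pow_left₀ (abs_nonneg _) h1 2
      · simpa using h1
    refine (Finset.sum_le_sum fun n _ => this n).trans ?_
    rw [hsum]
    exact le_of_eq (by field_simp)
  have hfx : f |x| < δ := by
    refine (functional_abs_sum_rademacher_le hu hf hh hfh c N).trans_lt ?_
    refine (mul_le_mul_of_nonneg_left (Real.sqrt_le_sqrt hc2) (hf u hu)).trans_lt ?_
    have h1 : f u / δ < √M := Real.lt_sqrt_of_sq_lt ((le_max_right _ _).trans_lt hM)
    rw [Real.sqrt_div zero_le_one, Real.sqrt_one, mul_one_div, div_lt_iff₀ (Real.sqrt_pos.2 hM0)]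
    rwa [div_lt_iff₀ hδ, mul_comm] at h1
  have hnorm := hsmall _ (abs_nonneg x) hxu hfx
  rw [norm_abs_eq_norm, lt_div_iff₀ (by positivity)] at hnorm
  have hgx : ε ≤ g x := by
    rw [hx, map_sum]
    calc ε = M * (ε / M) := by field_simp
      _ = ∑ n ∈ Finset.range N, (if n ∈ s then ε / M else 0) := (hsum _).symm
      _ ≤ _ := Finset.sum_le_sum fun n _ => by
        rw [map_smul, smul_eq_mul]
        by_cases hn : n ∈ s
        · simp only [c, hn, if_true]
          rw [div_mul_eq_mul_div, sign_mul_self]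
          refine div_le_div_of_nonneg_right ?_ hM0.le
          simpa using hs hn
        · simp [c, hn]
  have h1 := (le_abs_self _).trans (g.le_opNorm x)
  nlinarith [norm_nonneg x, norm_nonneg g]

end Weak

/-! ### Disjoint complements, atoms and their coordinates. -/

section Band

variable {X : Type u} [NormedAddCommGroup X] [NormedSpace ℝ X] [Lattice X]
  [IsOrderedAddMonoid X] [IsOrderedModule ℝ X]

theorem inf_smul_le {x y : X} (hx : 0 ≤ x) (hy : 0 ≤ y) (c : ℝ) :
    x ⊓ c • y ≤ max 1 c • (x ⊓ y) := by
  have h1 : (0 : ℝ) ≤ max 1 c := zero_le_one.trans (le_max_left _ _)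
  rw [smul_inf_of_nonneg h1]
  refine inf_le_inf ?_ (smul_le_smul_of_nonneg_right (le_max_right _ _) hy)
  simpa using smul_le_smul_of_nonneg_right (le_max_left 1 c) hx

/-- The disjoint complement of a positive vector. -/
def disjointComplement (w : X) (hw : 0 ≤ w) : Submodule ℝ X where
  carrier := {x | |x| ⊓ w = 0}
  zero_mem' := by simpa using hw
  add_mem' := fun {x y} hx hy =>
    inf_eq_zero_of_le (abs_nonneg _) hw (abs_add_le x y) le_rfl
      (add_inf_eq_zero (abs_nonneg x) (abs_nonneg y) hw hx hy)
  smul_mem' := fun c x hx => by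
    refine le_antisymm ?_ (le_inf (abs_nonneg _) hw)
    have := inf_smul_le hw (abs_nonneg x) |c|
    rwa [inf_comm, inf_comm w, hx, smul_zero, ← abs_smul_eq] at this

theorem mem_disjointComplement {w : X} {hw : 0 ≤ w} {x : X} :
    x ∈ disjointComplement w hw ↔ |x| ⊓ w = 0 := Iff.rfl

theorem isBand_disjointComplement (w : X) (hw : 0 ≤ w) : IsBand (disjointComplement w hw) where
  solid _ _ hy hxy := inf_eq_zero_of_le (abs_nonneg _) hw hxy le_rfl hy
  isLUB_mem S x hS hx := by
    -- A supremum of the empty set is a least element of `X`, which must be `0`.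
    rcases S.eq_empty_or_nonempty with rfl | ⟨s₀, hs₀⟩
    · have hb : ∀ y, x ≤ y := fun y => hx.2 (by simp)
      have hx0 : x = 0 := le_antisymm (hb 0) (by simpa using hb (x + x))
      rw [hx0]
      exact zero_mem _
    have hneg : x⁻ ⊓ w = 0 :=
      inf_eq_zero_of_le (negPart_nonneg x) hw
        ((negPart_anti (hx.1 hs₀)).trans (sup_le (neg_le_abs s₀) (abs_nonneg s₀))) le_rfl (hS hs₀)
    have hpos : x⁺ ⊓ w = 0 := by
      set z := x⁺ ⊓ w with hz
      have hz0 : 0 ≤ z := le_inf (posPart_nonneg x) hw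
      -- As `z` is disjoint from each `s⁺`, the sum `s⁺ + z` is a supremum and remains below `x⁺`.
      have hub : x ≤ x⁺ - z := hx.2 fun s hs => by
        have h1 : s⁺ ⊓ z = 0 := inf_eq_zero_of_le (posPart_nonneg s) hz0
          (sup_le (le_abs_self s) (abs_nonneg s)) inf_le_right (hS hs)
        have h2 : s⁺ + z ≤ x⁺ := by
          rw [← sup_eq_add_of_inf_eq_zero h1]
          exact sup_le (posPart_mono (hx.1 hs)) inf_le_left
        exact (le_posPart s).trans (le_sub_iff_add_le.2 h2)
      have h3 : x⁺ ≤ x⁺ - z := sup_le hub (sub_nonneg.2 inf_le_left)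
      exact le_antisymm (by simpa using h3) hz0
    rw [mem_disjointComplement, ← posPart_add_negPart]
    exact add_inf_eq_zero (posPart_nonneg x) (negPart_nonneg x) hw hpos hneg

end Band

section Atom

variable {X : Type u} [NormedAddCommGroup X] [NormedSpace ℝ X] [Lattice X]
  [IsOrderedAddMonoid X] [IsOrderedModule ℝ X]

theorem IsAtomVector.exists_eq_smul {a x : X} (ha : IsAtomVector a) (hx : 0 ≤ x) {t : ℝ}
    (hxt : x ≤ t • a) : ∃ s : ℝ, 0 ≤ s ∧ x = s • a := by
  have hmem : x ∈ principalIdeal a := ⟨|t|, abs_nonneg t, by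
    rw [abs_of_nonneg hx, ← abs_smul_eq]
    exact hxt.trans (le_abs_self _)⟩
  rw [ha.2.2] at hmem
  obtain ⟨s, rfl⟩ := Submodule.mem_span_singleton.1 hmem
  refine ⟨|s|, abs_nonneg s, ?_⟩
  conv_lhs => rw [← abs_of_nonneg hx, abs_smul_eq, abs_of_nonneg ha.1]

theorem IsAtomVector.exists_inf_eq_smul {a x : X} (ha : IsAtomVector a) (hx : 0 ≤ x) :
    ∃ s : ℝ, 0 ≤ s ∧ x ⊓ a = s • a :=
  ha.exists_eq_smul (t := 1) (le_inf hx ha.1) (by rw [one_smul]; exact inf_le_right)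

theorem IsAtomVector.smul {a : X} (ha : IsAtomVector a) {t : ℝ} (ht : 0 < t) :
    IsAtomVector (t • a) := by
  refine ⟨smul_nonneg ht.le ha.1, smul_ne_zero ht.ne' ha.2.1, ?_⟩
  rw [Submodule.span_singleton_smul_eq (IsUnit.mk0 t ht.ne'), ← ha.2.2]
  ext x
  constructor
  · rintro ⟨c, hc, hx⟩
    refine ⟨c * t, by positivity, ?_⟩
    rwa [abs_smul_eq, abs_of_pos ht, smul_smul] at hx
  · rintro ⟨c, hc, hx⟩
    refine ⟨c / t, by positivity, ?_⟩
    rwa [abs_smul_eq, abs_of_pos ht, smul_smul, div_mul_cancel₀ _ ht.ne']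

theorem IsAtomVector.exists_eq_smul_of_inf_ne_zero {a b : X} (ha : IsAtomVector a)
    (hb : IsAtomVector b) (h : b ⊓ a ≠ 0) : ∃ r : ℝ, a = r • b := by
  obtain ⟨s, -, hs⟩ := ha.exists_inf_eq_smul hb.1
  obtain ⟨t, -, ht⟩ := hb.exists_inf_eq_smul ha.1
  rw [inf_comm, hs] at ht
  have hs0 : s ≠ 0 := fun h0 => h (by rw [hs, h0, zero_smul])
  refine ⟨s⁻¹ * t, ?_⟩
  rw [mul_smul, ← ht, inv_smul_smul₀ hs0]

variable [HasSolidNorm X]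

/-- The coordinate functional of an atom, up to normalization. -/
theorem IsAtomVector.exists_coordinate {a : X} (ha : IsAtomVector a) :
    ∃ f : X →L[ℝ] ℝ, (∀ y, ‖|y| ⊓ a‖ ≤ |f y|) ∧ ∀ y, |y| ⊓ a = 0 → f y = 0 := by
  -- `N` plays the role of the norm of the projection of `x` onto the line of `a`. It vanishes on
  -- positive vectors disjoint from `a`, and so does any positive functional below it.
  let N : X → ℝ := fun x => ⨆ t : NNReal, ‖x ⊓ (t : ℝ) • a‖
  have hta : ∀ t : NNReal, 0 ≤ (t : ℝ) • a := fun t => smul_nonneg t.2 ha.1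
  have hle : ∀ x, 0 ≤ x → ∀ t : NNReal, ‖x ⊓ (t : ℝ) • a‖ ≤ ‖x‖ := fun x hx t =>
    norm_le_norm_of_nonneg_of_le (le_inf hx (hta t)) inf_le_left
  have hbdd : ∀ x, 0 ≤ x → BddAbove (Set.range fun t : NNReal => ‖x ⊓ (t : ℝ) • a‖) := fun x hx =>
    ⟨‖x‖, by rintro _ ⟨t, rfl⟩; exact hle x hx t⟩
  have hmul : ∀ c : ℝ, 0 < c → ∀ x, 0 ≤ x → N (c • x) ≤ c * N x := fun c hc x hx => by
    refine ciSup_le fun t => ?_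
    have : c • x ⊓ (t : ℝ) • a = c • (x ⊓ ((t / c.toNNReal : NNReal) : ℝ) • a) := by
      rw [smul_inf_of_nonneg hc.le, smul_smul]
      congr 2
      rw [NNReal.coe_div, Real.coe_toNNReal c hc.le]
      exact (mul_div_cancel₀ _ hc.ne').symm
    rw [this, norm_smul, Real.norm_of_nonneg hc.le]
    exact mul_le_mul_of_nonneg_left (le_ciSup (hbdd x hx) _) hc.le
  obtain ⟨f, hfa, hf, hfN⟩ := exists_positive_functional (u := a) N 1
    (fun x _ => Real.iSup_nonneg fun _ => norm_nonneg _)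
    (fun x hx => by rw [one_mul]; exact ciSup_le (hle x hx))
    (fun c hc x hx => by
      refine le_antisymm (hmul c hc x hx) ?_
      have := hmul c⁻¹ (inv_pos.2 hc) (c • x) (smul_nonneg hc.le hx)
      rwa [inv_smul_smul₀ hc.ne', le_inv_mul_iff₀ hc] at this)
    (fun x y hx hy => ciSup_le fun t => by
      refine (norm_le_norm_of_nonneg_of_le (le_inf (add_nonneg hx hy) (hta t))
        (add_inf_le_inf_add_inf hx hy (hta t))).trans ((norm_add_le _ _).trans ?_)
      exact add_le_add (le_ciSup (hbdd x hx) t) (le_ciSup (hbdd y hy) t))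
    (fun x y hx hxy => ciSup_mono (hbdd y (hx.trans hxy)) fun t =>
      norm_le_norm_of_nonneg_of_le (le_inf hx (hta t)) (inf_le_inf_right _ hxy))
    ha.1 ha.2.1
  have hfa' : ‖a‖ ≤ f a := by
    rw [hfa]
    simpa using le_ciSup (hbdd a ha.1) 1
  have hzero : ∀ y, 0 ≤ y → y ⊓ a = 0 → f y = 0 := fun y hy hya => by
    refine le_antisymm ((hfN y hy).trans (ciSup_le fun t => ?_)) (hf y hy)
    have h0 : y ⊓ (t : ℝ) • a = 0 := le_antisymm
      (by simpa [hya] using inf_smul_le hy ha.1 (t : ℝ)) (le_inf hy (hta t))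
    rw [h0, norm_zero]
  have hcase : ∀ y, y⁻ ⊓ a = 0 → ‖|y| ⊓ a‖ ≤ |f y| := fun y hy => by
    obtain ⟨s, hs0, hs⟩ := ha.exists_inf_eq_smul (posPart_nonneg y)
    have h1 : |y| ⊓ a ≤ s • a := by
      rw [← posPart_add_negPart]
      refine (add_inf_le_inf_add_inf (posPart_nonneg y) (negPart_nonneg y) ha.1).trans ?_
      rw [hy, add_zero, hs]
    have h2 : f y = f y⁺ := by
      conv_lhs => rw [← posPart_sub_negPart y, map_sub, hzero _ (negPart_nonneg y) hy, sub_zero]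
    calc ‖|y| ⊓ a‖ ≤ ‖s • a‖ := norm_le_norm_of_nonneg_of_le (le_inf (abs_nonneg y) ha.1) h1
      _ = s * ‖a‖ := by rw [norm_smul, Real.norm_of_nonneg hs0]
      _ ≤ s * f a := mul_le_mul_of_nonneg_left hfa' hs0
      _ = f (y⁺ ⊓ a) := by rw [hs, map_smul, smul_eq_mul]
      _ ≤ f y⁺ := functional_mono hf inf_le_left
      _ = f y := h2.symm
      _ ≤ |f y| := le_abs_self _
  refine ⟨f, fun y => ?_, fun y hy => ?_⟩
  · obtain ⟨s, hs0, hs⟩ := ha.exists_inf_eq_smul (posPart_nonneg y)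
    obtain ⟨r, hr0, hr⟩ := ha.exists_inf_eq_smul (negPart_nonneg y)
    -- The meets of `y⁺` and `y⁻` with `a` are disjoint multiples of `a`, so the one with the
    -- smaller coefficient is zero.
    have h0 : (s • a) ⊓ (r • a) = 0 := by
      rw [← hs, ← hr]
      exact inf_eq_zero_of_le (le_inf (posPart_nonneg y) ha.1) (le_inf (negPart_nonneg y) ha.1)
        inf_le_left inf_le_left (posPart_inf_negPart_eq_zero y)
    rcases le_total r s with h | h
    · rw [inf_eq_right.2 (smul_le_smul_of_nonneg_right h ha.1)] at h0
      exact hcase y (hr.trans h0)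
    · rw [inf_eq_left.2 (smul_le_smul_of_nonneg_right h ha.1)] at h0
      have := hcase (-y) (by rw [negPart_neg]; exact hs.trans h0)
      rwa [abs_neg, map_neg, abs_neg] at this
  · rw [← posPart_sub_negPart y, map_sub,
      hzero _ (posPart_nonneg y) (inf_eq_zero_of_le (posPart_nonneg y) ha.1
        (sup_le (le_abs_self y) (abs_nonneg y)) le_rfl hy),
      hzero _ (negPart_nonneg y) (inf_eq_zero_of_le (negPart_nonneg y) ha.1
        (sup_le (neg_le_abs y) (abs_nonneg y)) le_rfl hy), sub_zero]

end Atom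

/-! ### Approximation by sums of atoms. -/

section Atomic

variable {X : Type u} [NormedAddCommGroup X] [NormedSpace ℝ X] [Lattice X]
  [IsOrderedAddMonoid X]

variable (X) in
/-- The finite sums of atoms. -/
def atomSums : AddSubmonoid X := AddSubmonoid.closure {a | IsAtomVector a}

theorem nonneg_of_mem_atomSums {w : X} (hw : w ∈ atomSums X) : 0 ≤ w :=
  AddSubmonoid.closure_induction (fun _ ha => ha.1) le_rfl (fun _ _ _ _ => add_nonneg) hw

theorem exists_finite_of_mem_atomSums {w : X} (hw : w ∈ atomSums X) :
    ∃ F : Set X, F.Finite ∧ (∀ b ∈ F, IsAtomVector b) ∧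
      ∀ a, 0 ≤ a → (∀ b ∈ F, b ⊓ a = 0) → w ⊓ a = 0 := by
  induction hw using AddSubmonoid.closure_induction with
  | mem b hb => exact ⟨{b}, Set.finite_singleton b, by simpa using hb, fun a _ h => h b rfl⟩
  | zero => exact ⟨∅, Set.finite_empty, by simp, fun a ha _ => by simpa using ha⟩
  | add x y hx hy ihx ihy =>
    obtain ⟨F, hF, hFa, hF'⟩ := ihx
    obtain ⟨G, hG, hGa, hG'⟩ := ihy
    refine ⟨F ∪ G, hF.union hG, fun b hb => hb.elim (hFa b) (hGa b), fun a ha h => ?_⟩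
    exact add_inf_eq_zero (nonneg_of_mem_atomSums hx) (nonneg_of_mem_atomSums hy) ha
      (hF' a ha fun b hb => h b (Or.inl hb)) (hG' a ha fun b hb => h b (Or.inr hb))

variable [HasSolidNorm X] [CompleteSpace X]

/-- If no positive nonzero vector is disjoint from all atoms, then the lattice is atomic. -/
theorem MonotoneBoundedCauchy.isAtomicLattice (hX : MonotoneBoundedCauchy X)
    (h : ∀ u : X, 0 ≤ u → (∀ a, IsAtomVector a → u ⊓ a = 0) → u = 0) : IsAtomicLattice X := by
  rw [IsAtomicLattice, eq_top_iff]
  refine le_sInf ?_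
  rintro B ⟨hB, hA⟩ x -
  suffices hpos : ∀ u : X, 0 ≤ u → u ∈ B from
    hB.solid (hpos |x| (abs_nonneg x)) (abs_abs x).ge
  intro u hu
  have hmono : ∀ {y z : X}, 0 ≤ y → y ≤ z → z ∈ B → y ∈ B := fun hy hyz hz =>
    hB.solid hz (by rwa [abs_of_nonneg hy, abs_of_nonneg (hy.trans hyz)])
  obtain ⟨s, -, hlub⟩ := hX.exists_isLUB_mem_closure (D := {v | v ∈ B ∧ 0 ≤ v ∧ v ≤ u})
    ⟨0, zero_mem _, le_rfl, hu⟩ (by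
      rintro y ⟨hy, hy0, hyu⟩ z ⟨hz, hz0, hzu⟩
      exact ⟨y ⊔ z, ⟨hmono (hy0.trans le_sup_left) (sup_le (le_add_of_nonneg_right hz0)
        (le_add_of_nonneg_left hy0)) (add_mem hy hz), hy0.trans le_sup_left, sup_le hyu hzu⟩,
        le_sup_left, le_sup_right⟩)
    ⟨u, fun v hv => hv.2.2⟩
  have hsB : s ∈ B := hB.isLUB_mem (fun v hv => hv.1) hlub
  have hsu : s ≤ u := hlub.2 fun v hv => hv.2.2
  have hs0 : 0 ≤ s := hlub.1 ⟨zero_mem _, le_rfl, hu⟩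
  have hd0 : 0 ≤ u - s := sub_nonneg.2 hsu
  -- `s` is the largest part of `u` in `B`; the meet of `u - s` with an atom lies in `B` and could
  -- be added to it.
  have : u - s = 0 := h _ hd0 fun a ha => by
    have h0 : 0 ≤ (u - s) ⊓ a := le_inf hd0 ha.1
    have hmem : (u - s) ⊓ a ∈ B := hmono h0 inf_le_right (hA ha)
    have hle : s + (u - s) ⊓ a ≤ s := hlub.1 ⟨add_mem hsB hmem, add_nonneg hs0 h0,
      (add_le_add_right inf_le_left s).trans (add_sub_cancel s u).le⟩
    exact le_antisymm (by simpa using hle) h0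
  rwa [sub_eq_zero.1 this]

variable [IsOrderedModule ℝ X]

/-- Let `s` be the supremum of the meets. If `u - s` met an atom, the meet would be a positive
multiple of it and could be added to the sums. Hence the band of vectors disjoint from `u - s`
contains all atoms, so it is `X`, and `u - s` is disjoint from itself. -/
theorem MonotoneBoundedCauchy.mem_closure_inf_atomSums (hX : MonotoneBoundedCauchy X)
    (hat : IsAtomicLattice X) (u : X) :
    u ∈ closure {y | ∃ w ∈ atomSums X, y = u ⊓ w} := by
  obtain ⟨s, hs, hlub⟩ := hX.exists_isLUB_mem_closure (D := {y | ∃ w ∈ atomSums X, y = u ⊓ w})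
    ⟨u ⊓ 0, 0, zero_mem _, rfl⟩ (by
      rintro _ ⟨w, hw, rfl⟩ _ ⟨z, hz, rfl⟩
      exact ⟨u ⊓ (w + z), ⟨_, add_mem hw hz, rfl⟩,
        inf_le_inf_left _ (le_add_of_nonneg_right (nonneg_of_mem_atomSums hz)),
        inf_le_inf_left _ (le_add_of_nonneg_left (nonneg_of_mem_atomSums hw))⟩)
    ⟨u, by rintro _ ⟨w, -, rfl⟩; exact inf_le_left⟩
  have hsu : s ≤ u := hlub.2 (by rintro _ ⟨w, -, rfl⟩; exact inf_le_left)
  have hd0 : 0 ≤ u - s := sub_nonneg.2 hsu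
  have hdisj : ∀ a, IsAtomVector a → a ⊓ (u - s) = 0 := fun a ha => by
    obtain ⟨t, ht0, ht⟩ := ha.exists_inf_eq_smul hd0
    rw [inf_comm, ht]
    rcases ht0.eq_or_lt with rfl | ht0
    · exact zero_smul ℝ a
    have hle : s ≤ s - t • a := hlub.2 (by
      rintro _ ⟨w, hw, rfl⟩
      refine le_sub_iff_add_le.2 (le_trans (le_inf ?_ ?_) (hlub.1 ⟨w + t • a,
        add_mem hw (AddSubmonoid.subset_closure (ha.smul ht0)), rfl⟩))
      · calc u ⊓ w + t • a ≤ s + (u - s) :=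
              add_le_add (hlub.1 ⟨w, hw, rfl⟩) (ht ▸ inf_le_left)
          _ = u := add_sub_cancel _ _
      · exact add_le_add_left inf_le_right _)
    exact le_antisymm (by simpa using hle) (smul_nonneg ht0.le ha.1)
  have htop : (⊤ : Submodule ℝ X) ≤ disjointComplement (u - s) hd0 := by
    rw [← hat]
    refine sInf_le ⟨isBand_disjointComplement _ _, fun a ha => ?_⟩
    rw [SetLike.mem_coe, mem_disjointComplement, abs_of_nonneg ha.1]
    exact hdisj a ha
  have h0 : |u - s| ⊓ (u - s) = 0 := htop (Submodule.mem_top (x := u - s))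
  rw [abs_of_nonneg hd0, inf_idem] at h0
  rwa [← sub_eq_zero.1 h0] at hs

theorem MonotoneBoundedCauchy.exists_countable_atoms (hX : MonotoneBoundedCauchy X)
    (hat : IsAtomicLattice X) {u : X} (hu : 0 ≤ u) :
    ∃ A : Set X, A.Countable ∧ (∀ b ∈ A, IsAtomVector b) ∧
      ∀ a, 0 ≤ a → (∀ b ∈ A, b ⊓ a = 0) → u ⊓ a = 0 := by
  have h := Metric.mem_closure_iff.1 (hX.mem_closure_inf_atomSums hat u)
  have h' : ∀ k : ℕ, ∃ w ∈ atomSums X, ‖u - u ⊓ w‖ < 1 / ((k : ℝ) + 1) := fun k => by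
    obtain ⟨_, ⟨w, hw, rfl⟩, hlt⟩ := h (1 / ((k : ℝ) + 1)) (by positivity)
    exact ⟨w, hw, by rwa [← dist_eq_norm]⟩
  choose w hw hlt using h'
  choose F hF hFa hF' using fun k => exists_finite_of_mem_atomSums (hw k)
  refine ⟨⋃ k, F k, Set.countable_iUnion fun k => (hF k).countable, fun b hb => ?_,
    fun a ha h => ?_⟩
  · obtain ⟨k, hk⟩ := Set.mem_iUnion.1 hb
    exact hFa k b hk
  · have hk : ∀ k : ℕ, ‖u ⊓ a‖ ≤ 1 / ((k : ℝ) + 1) := fun k => by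
      have h0 := hF' k a ha fun b hb => h b (Set.mem_iUnion.2 ⟨k, hb⟩)
      have h1 : (u ⊓ w k) ⊓ a = 0 :=
        inf_eq_zero_of_le (le_inf hu (nonneg_of_mem_atomSums (hw k))) ha inf_le_right le_rfl h0
      have := norm_inf_sub_inf_le_norm u (u ⊓ w k) a
      rw [h1, sub_zero] at this
      exact this.trans (hlt k).le
    have := ge_of_tendsto' (tendsto_one_div_add_atTop_nhds_zero_nat (𝕜 := ℝ)) hk
    exact norm_le_zero_iff.1 this

/-- In an atomic Banach lattice with order continuous norm, un-convergence can be tested on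
atoms. -/
theorem MonotoneBoundedCauchy.unTendsto_of_forall_atom (hX : MonotoneBoundedCauchy X)
    (hat : IsAtomicLattice X) {ι : Type*} {l : Filter ι} {x : ι → X} {y : X}
    (h : ∀ a, IsAtomVector a → Tendsto (fun i => ‖|x i - y| ⊓ a‖) l (𝓝 0)) : UnTendsto x l y := by
  have hsum : ∀ w ∈ atomSums X, Tendsto (fun i => ‖|x i - y| ⊓ w‖) l (𝓝 0) := fun w hw => by
    induction hw using AddSubmonoid.closure_induction with
    | mem a ha => exact h a ha
    | zero => simpa [inf_eq_right.2 (abs_nonneg _)] using tendsto_const_nhds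
    | add w z hw hz ihw ihz =>
      have hw0 := nonneg_of_mem_atomSums hw
      have hz0 := nonneg_of_mem_atomSums hz
      have hlim := ihw.add ihz
      rw [add_zero] at hlim
      refine squeeze_zero (fun _ => norm_nonneg _) (fun i => ?_) hlim
      exact (norm_le_norm_of_nonneg_of_le (le_inf (abs_nonneg _) (add_nonneg hw0 hz0))
        (inf_add_le_inf_add_inf hw0 hz0 (abs_nonneg _))).trans (norm_add_le _ _)
  intro u hu
  refine Metric.tendsto_nhds.2 fun ε hε => ?_
  obtain ⟨_, ⟨w, hw, rfl⟩, hlt⟩ := Metric.mem_closure_iff.1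
    (hX.mem_closure_inf_atomSums hat u) (ε / 2) (half_pos hε)
  rw [dist_eq_norm] at hlt
  filter_upwards [(hsum w hw).eventually (gt_mem_nhds (half_pos hε))] with i hi
  rw [Real.dist_0_eq_abs, abs_norm]
  have hw0 := nonneg_of_mem_atomSums hw
  have h0 : 0 ≤ u - u ⊓ w := sub_nonneg.2 inf_le_left
  have hle : |x i - y| ⊓ u ≤ |x i - y| ⊓ w + (u - u ⊓ w) := by
    calc |x i - y| ⊓ u = |x i - y| ⊓ (u ⊓ w + (u - u ⊓ w)) := by rw [add_sub_cancel]
      _ ≤ |x i - y| ⊓ (u ⊓ w) + |x i - y| ⊓ (u - u ⊓ w) :=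
          inf_add_le_inf_add_inf (le_inf hu hw0) h0 (abs_nonneg _)
      _ ≤ _ := add_le_add (inf_le_inf_left _ inf_le_right) inf_le_right
  have := (norm_le_norm_of_nonneg_of_le (le_inf (abs_nonneg _) hu) hle).trans (norm_add_le _ _)
  linarith

end Atomic

/-! ### The two implications. -/

section Main

variable {X : Type u} [NormedAddCommGroup X] [NormedSpace ℝ X] [CompleteSpace X] [Lattice X]
  [IsOrderedAddMonoid X] [IsOrderedModule ℝ X] [HasSolidNorm X]

theorem isAtomicLattice_of_forall_isSeqUnCompactOperator
    (H : ∀ (E : Type v) [NormedAddCommGroup E] [NormedSpace ℝ E] [CompleteSpace E] (T : E →L[ℝ] X),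
      IsWeaklyCompactOperator T → IsSeqUnCompactOperator T) :
    IsAtomicLattice X := by
  have hX := monotoneBoundedCauchy_of_forall_isSeqUnCompactOperator H
  refine hX.isAtomicLattice fun u hu hua => ?_
  by_contra hu0
  obtain ⟨w, hw, hwu, hw0, f, hf, hfw⟩ := hX.exists_strictlyPositive hu hu0
  have hna : ∀ a, IsAtomVector a → ¬ a ≤ w := fun a ha haw => by
    have := hua a ha
    rw [inf_eq_right.2 (haw.trans hwu)] at this
    exact ha.2.1 this
  choose! h hh hfh using fun p (hp : 0 ≤ p) (hpw : p ≤ w) => hX.exists_half hf hfw hna hp hpw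
  obtain ⟨φ, -, hφ⟩ := exists_subseq_tendsto_zero H
    (fun n => (abs_rademacher hw hh n).le) (hX.tendsto_functional_rademacher hw hf hfw hh hfh)
  have hnorm : ∀ n, ‖rademacher h w n‖ = ‖w‖ := fun n => by
    rw [← norm_abs_eq_norm, abs_rademacher hw hh]
  have := hφ.norm
  simp only [Function.comp_def, hnorm, norm_zero] at this
  exact hw0 (norm_eq_zero.1 (tendsto_nhds_unique tendsto_const_nhds this))

theorem isSeqUnCompactOperator_of_isWeaklyCompactOperator (hat : IsAtomicLattice X)
    (hX : MonotoneBoundedCauchy X) {E : Type*} [NormedAddCommGroup E] [NormedSpace ℝ E]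
    {T : E →L[ℝ] X} (hT : IsWeaklyCompactOperator T) : IsSeqUnCompactOperator T := by
  intro x hx
  choose A hA hAa hA' using fun n => hX.exists_countable_atoms hat (abs_nonneg (x n))
  choose! f hf hf0 using fun (a : X) (ha : IsAtomVector a) => ha.exists_coordinate
  let B : Set X := ⋃ n, A n
  have hB : B.Countable := Set.countable_iUnion hA
  have hBa : ∀ b ∈ B, IsAtomVector b := fun b hb => by
    obtain ⟨n, hn⟩ := Set.mem_iUnion.1 hb
    exact hAa n b hn
  have : Countable B := hB.to_subtype
  have hxT : ∀ n, ‖x n‖ ≤ ‖T‖ := fun n => by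
    obtain ⟨e, he, hxe⟩ := hx n
    rw [← hxe]
    exact T.unit_le_opNorm e (mem_closedBall_zero_iff.1 he)
  -- The diagonal argument: a countable product of compact intervals is sequentially compact.
  obtain ⟨c, -, φ, hφ, hc⟩ := (isCompact_univ_pi fun b : B =>
    isCompact_closedBall (0 : ℝ) (‖f b‖ * ‖T‖)).tendsto_subseq (x := fun n (b : B) => f b (x n))
      fun n b _ => mem_closedBall_zero_iff.2
        (((f b).le_opNorm (x n)).trans (mul_le_mul_of_nonneg_left (hxT n) (norm_nonneg _)))
  obtain ⟨y, -, hy⟩ := hT.exists_mapClusterPt (u := fun n => toWeakSpace ℝ X (x (φ n)))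
    (f := atTop) (tendsto_principal.2 (Eventually.of_forall fun n =>
      subset_closure ⟨_, hx (φ n), rfl⟩))
  let y' : X := (toWeakSpace ℝ X).symm y
  have hlim : ∀ (g : X →L[ℝ] ℝ) (t : ℝ), Tendsto (fun n => g (x (φ n))) atTop (𝓝 t) →
      g y' = t := by
    intro g t ht
    have hg : Continuous fun z : WeakSpace ℝ X => g ((toWeakSpace ℝ X).symm z) :=
      WeakBilin.eval_continuous _ g
    have hcl := MapClusterPt.tendsto_comp (hg.tendsto y) hy
    have : (𝓝 (g y') ⊓ 𝓝 t).NeBot := ClusterPt.mono hcl ht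
    exact eq_of_nhds_neBot this
  have hB0 : ∀ b ∈ B, Tendsto (fun n => ‖|x (φ n) - y'| ⊓ b‖) atTop (𝓝 0) := fun b hb => by
    have h1 : Tendsto (fun n => f b (x (φ n))) atTop (𝓝 (c ⟨b, hb⟩)) :=
      (tendsto_pi_nhds.1 hc) ⟨b, hb⟩
    have h2 := (h1.sub_const (f b y')).abs
    rw [hlim _ _ h1, sub_self, abs_zero] at h2
    refine squeeze_zero (fun _ => norm_nonneg _) (fun n => ?_) h2
    have := hf b (hBa b hb) (x (φ n) - y')
    rwa [map_sub, hlim _ _ h1] at this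
  refine ⟨y', φ, hφ, hX.unTendsto_of_forall_atom hat fun a ha => ?_⟩
  by_cases hab : ∃ b ∈ B, b ⊓ a ≠ 0
  · obtain ⟨b, hb, hba⟩ := hab
    obtain ⟨r, rfl⟩ := ha.exists_eq_smul_of_inf_ne_zero (hBa b hb) hba
    have h1 := (hB0 b hb).const_mul (max 1 r)
    rw [mul_zero] at h1
    refine squeeze_zero (fun _ => norm_nonneg _) (fun n => ?_) h1
    refine (norm_le_norm_of_nonneg_of_le (le_inf (abs_nonneg _) ha.1)
      (inf_smul_le (abs_nonneg _) (hBa b hb).1 r)).trans ?_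
    rw [norm_smul, Real.norm_of_nonneg (zero_le_one.trans (le_max_left _ _))]
    rfl
  · push Not at hab
    have h0 : ∀ n, f a (x n) = 0 := fun n =>
      hf0 a ha _ (hA' n a ha.1 fun b hb => hab b (Set.mem_iUnion.2 ⟨n, hb⟩))
    have hy0 : f a y' = 0 := hlim _ _ (by simp only [h0]; exact tendsto_const_nhds)
    refine squeeze_zero (fun _ => norm_nonneg _) (fun n => ?_) (tendsto_const_nhds (x := (0 : ℝ)))
    have := hf a ha (x (φ n) - y')
    rwa [map_sub, h0, hy0, sub_self, abs_zero] at this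

end Main

end BanachLattice

theorem mainTheorem12 (X : Type u) [NormedAddCommGroup X] [NormedSpace ℝ X]
    [CompleteSpace X] [Lattice X] [IsOrderedAddMonoid X] [IsOrderedModule ℝ X] [HasSolidNorm X] :
    (BanachLattice.IsAtomicLattice X ∧ BanachLattice.IsOrderContinuous X) ↔
      ∀ (E : Type v) [NormedAddCommGroup E] [NormedSpace ℝ E] [CompleteSpace E] (T : E →L[ℝ] X),
        BanachLattice.IsWeaklyCompactOperator T → BanachLattice.IsSeqUnCompactOperator T := by
  constructor
  · rintro ⟨hat, hoc⟩ E _ _ _ T hT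
    exact BanachLattice.isSeqUnCompactOperator_of_isWeaklyCompactOperator hat
      hoc.monotoneBoundedCauchy hT
  · intro H
    exact ⟨BanachLattice.isAtomicLattice_of_forall_isSeqUnCompactOperator H,
      (BanachLattice.monotoneBoundedCauchy_of_forall_isSeqUnCompactOperator H).isOrderContinuous⟩
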